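/- **Setting.** For $k\in\mathbb Z$ let $S_k$ be the set of sequences $\{\alpha\}_k=\{\alpha_i\}_{i\le k}$ of non-negative integers with $\alpha_i=0$ for all $i\le N$, for some integer $N\le k$, and let $S=\bigcup_{k\in\mathbb Z}S_k$. Let $B:S\to\{2,3,4,\dots\}$, $\{\alpha\}_k\mapsto B_{\{\alpha\}_k}$, be any function. Let $\mathbb S_B$ be the set of two-sided sequences $\alpha=\{\alpha_i\}_{i\in\mathbb Z}$ of non-negative integers which vanish for all sufficiently negative $i$ and satisfy $0\le\alpha_{k+1}\le B_{\{\alpha\}_k}-1$ for all $k\in\mathbb Z$, where $\{\alpha\}_k=\{\alpha_i\}_{i\le k}$. Fix a real $q>1$ and equip $\mathbb S_B$ with the metric $\rho(\alpha,\alpha)=0$, $\rho(\alpha,\beta)=q^{-i_0}$ for $\alpha\ne\beta$, where $i_0=\min\{i:\alpha_i\ne\beta_i\}$. The balls are $K(\alpha,q^N)=\{\beta:\rho(\alpha,\beta)\le q^N\}$, $\alpha\in\mathbb S_B$, $N\in\mathbb Z$. Write $b_\alpha(n)=B_{\{\alpha\}_{-n}}$. Let $\mu$ be the Borel measure on $\mathbb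 S_B$ with $\mu(K(0,q^0))=1$ and $\mu(K(\alpha,q^M))=b_\alpha(M+1)\,\mu(K(\alpha,q^{M-1}))$ for all $\alpha\in\mathbb S_B$, $M\in\mathbb Z$. Let $(a(N))_{N\in\mathbb Z}$ be real numbers with $a(N)\ge a(N+1)$ for all $N$, $\lim_{N\to\infty}a(N)=0$ and $\lim_{N\to-\infty}a(N)=W$, where $W$ is a positive real number or $+\infty$. For $\alpha \in \mathbb S_B$, $m\ge1$, $M\in\mathbb Z$ put $$B(\alpha,m,M)=(b_\alpha(M+m+1)-1)\prod_{j=2}^{m}b_\alpha(M+j),\qquad u(\alpha,m,M)=\frac{a(M+m-1)-a(M+m)}{B(\alpha,m,M)},$$ $$E_M(\alpha,t)=\exp\{-(a(M)+u(\alpha,1,M))t\},\qquad Q_M(\alpha,t)=\sum_{n=0}^\infty\Big(\prod_{j=0}^{n}b_\alpha(M+j+2)\Big)^{-1}(b_\alpha(M+n+2)-1)\,E_{M+n}(\alpha,t).$$ For $t>0$ and $\alpha\in\mathbb S_B$ let $P(\alpha,\cdot,t)$ be the Borel measure on $\mathbb S_B$ with $P(\alpha,K(\alpha,q^M),t)=Q_M(\alpha,t)$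 for all $M\in\mathbb Z$, and $$P(\alpha,K(\beta,q^M),t)=B(\beta,k,M)^{-1}\,\frac{b_\alpha(M+k+1)-1}{b_\alpha(M+k+1)}\,\big[Q_{M+k}(\alpha,t)-E_{M+k-1}(\alpha,t)\big]$$ whenever $\rho(\alpha,\beta)=q^{M+k}$ with $k\ge1$. Let $T_t$, $t>0$, be the bounded operator in the real Hilbert space $L^2(\mathbb S_B,\mu)$ with $(T_tf)(\eta)=\int_{\mathbb S_B}f(\xi)\,P(\eta,d\xi,t)$ for $\mu$-almost all $\eta$, and let $H$ be the operator in $L^2(\mathbb S_B,\mu)$ given by $$Hf=\lim_{t\downarrow0}t^{-1}(f-T_tf)$$ on the domain $D(H)$ of all $f$ for which this limit exists in the norm of $L^2(\mathbb S_B,\mu)$ (so that $-H$ is the generator of $T_t$). **Corollary 4.4.** Let $D_0$ be the linear span of the indicator functions of all balls $K(\alpha,q^N)$, $\alpha\in\mathbb S_B$, $N\in\mathbb Z$. Then $D_0\subset D(H)$, and $D_0$ is an operator core for $H$ in $L^2(\mathbb S_B,\mu)$, i.e. the closure of the restriction of $H$ to $D_0$ is $H$. -/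

import Mathlib

open MeasureTheory Filter Topology
open scoped ENNReal

noncomputable section

namespace Multibranch

/-- `S_k`: the sequences `{α_i}_{i ≤ k}` of non-negative integers that vanish for all `i ≤ N`,
for some integer `N ≤ k`. -/
def SeqUpTo (k : ℤ) : Type :=
  {s : Set.Iic k → ℕ // ∃ N ≤ k, ∀ i : Set.Iic k, (i : ℤ) ≤ N → s i = 0}

/-- `S`, the (disjoint) union of the sets `S_k`, `k ∈ ℤ`. -/
abbrev FinSeq : Type := Σ k : ℤ, SeqUpTo k

/-- The zero sequence `{0}_k`. -/
def zeroSeq (k : ℤ) : FinSeq :=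
  ⟨k, fun _ => 0, k, le_rfl, fun _ _ => rfl⟩

/-- The initial part `{α}_k = {α_i}_{i ≤ k}` of a two-sided sequence which vanishes
near `-∞`. -/
def initialPart (α : ℤ → ℕ) (h : ∃ N : ℤ, ∀ i ≤ N, α i = 0) (k : ℤ) : FinSeq :=
  ⟨k, fun i => α i, by
    obtain ⟨N, hN⟩ := h
    exact ⟨min N k, min_le_right _ _, fun i hi => hN _ (hi.trans (min_le_left _ _))⟩⟩

/-- The state space `𝕊_B`: the two-sided sequences `α` all of whose initial parts `{α}_k` arise
from a zero sequence by finitely many `B`-products, that is, `α` vanishes near `-∞` and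
`0 ≤ α_{k+1} ≤ B({α}_k) - 1` for all `k`. The number `q` is the base of the metric; it is
a parameter of the type so that the metric can be an instance. -/
@[ext]
structure SB (B : FinSeq → ℕ) (q : ℝ) where
  seq : ℤ → ℕ
  eventually_zero : ∃ N : ℤ, ∀ i ≤ N, seq i = 0
  lt_branching : ∀ k : ℤ, seq (k + 1) < B (initialPart seq eventually_zero k)

variable {B : FinSeq → ℕ} {q : ℝ}

namespace SB

/-- `B({α}_{-n})`. -/
def br (α : SB B q) (n : ℤ) : ℕ := B (initialPart α.seq α.eventually_zero (-n))

/-- For `α ≠ β`, the index `i₀` with `α_{i₀} ≠ β_{i₀}` and `α_i = β_i` for all `i < i₀`. -/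
def firstDiff (α β : SB B q) : ℤ := sInf {i : ℤ | α.seq i ≠ β.seq i}

open Classical in
/-- The distance `ρ_q(α, β) = q^{-i₀}` for `α ≠ β`, and `ρ_q(α, α) = 0`. -/
def rho (α β : SB B q) : ℝ := if α = β then 0 else q ^ (-firstDiff α β)

theorem bddBelow_diff (α β : SB B q) : BddBelow {i : ℤ | α.seq i ≠ β.seq i} := by
  obtain ⟨N, hN⟩ := α.eventually_zero
  obtain ⟨N', hN'⟩ := β.eventually_zero
  refine ⟨min N N', fun i hi => ?_⟩
  by_contra hlt
  push Not at hlt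
  exact hi ((hN i (hlt.le.trans (min_le_left _ _))).trans
    (hN' i (hlt.le.trans (min_le_right _ _))).symm)

theorem diff_nonempty {α β : SB B q} (h : α ≠ β) : {i : ℤ | α.seq i ≠ β.seq i}.Nonempty := by
  by_contra hne
  rw [Set.not_nonempty_iff_eq_empty] at hne
  apply h
  ext i
  by_contra hi
  have : i ∈ {i : ℤ | α.seq i ≠ β.seq i} := hi
  rw [hne] at this
  exact this

theorem firstDiff_spec {α β : SB B q} (h : α ≠ β) :
    α.seq (firstDiff α β) ≠ β.seq (firstDiff α β) :=
  Int.csInf_mem (diff_nonempty h) (bddBelow_diff α β)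

theorem firstDiff_le {α β : SB B q} {i : ℤ} (h : α.seq i ≠ β.seq i) : firstDiff α β ≤ i :=
  csInf_le (bddBelow_diff α β) h

theorem rho_self (α : SB B q) : rho α α = 0 := by simp [rho]

theorem rho_comm (α β : SB B q) : rho α β = rho β α := by
  by_cases h : α = β
  · rw [h]
  · rw [rho, rho, if_neg h, if_neg (Ne.symm h)]
    simp only [firstDiff, ne_comm]

theorem rho_le_max (hq : 1 < q) (α β γ : SB B q) :
    rho α γ ≤ max (rho α β) (rho β γ) := by
  have hq0 : 0 < q := zero_lt_one.trans hq
  by_cases h1 : α = β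
  · subst h1; exact le_max_right _ _
  by_cases h2 : β = γ
  · subst h2; exact le_max_left _ _
  by_cases h3 : α = γ
  · subst h3
    rw [rho_self]
    refine le_max_of_le_left ?_
    rw [rho, if_neg h1]
    positivity
  rw [rho, rho, rho, if_neg h1, if_neg h2, if_neg h3]
  by_cases h : α.seq (firstDiff α γ) = β.seq (firstDiff α γ)
  · refine le_max_of_le_right (zpow_le_zpow_right₀ hq.le (neg_le_neg (firstDiff_le ?_)))
    rw [← h]
    exact firstDiff_spec h3
  · exact le_max_of_le_left (zpow_le_zpow_right₀ hq.le (neg_le_neg (firstDiff_le h)))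

instance [hq : Fact (1 < q)] : MetricSpace (SB B q) where
  dist := rho
  dist_self := rho_self
  dist_comm := rho_comm
  dist_triangle α β γ := by
    have hq0 : 0 < q := zero_lt_one.trans hq.out
    have hn : ∀ α β : SB B q, 0 ≤ rho α β := fun α β => by
      unfold rho; split_ifs <;> positivity
    exact (rho_le_max hq.out α β γ).trans (max_le_add_of_nonneg (hn _ _) (hn _ _))
  eq_of_dist_eq_zero {α β} h := by
    have hq0 : 0 < q := zero_lt_one.trans hq.out
    by_contra hne
    have h' : q ^ (-firstDiff α β) = 0 := by
      have h'' : rho α β = 0 := h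
      rwa [rho, if_neg hne] at h''
    exact (zpow_pos hq0 _).ne' h'

instance [Fact (1 < q)] : MeasurableSpace (SB B q) := borel _

instance [Fact (1 < q)] : BorelSpace (SB B q) := ⟨rfl⟩

/-- The ball `K(α, q^N) = {β : ρ(α, β) ≤ q^N}`; it consists of the `β` with
`{β}_{-(N+1)} = {α}_{-(N+1)}`. -/
def ball [Fact (1 < q)] (α : SB B q) (N : ℤ) : Set (SB B q) := Metric.closedBall α (q ^ N)

/-- The Borel measure obtained by Carathéodory's (metric) construction from a set function on
balls; `c α N` is the value prescribed for the ball `K(α, q^N)`. Sets are covered by countably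
many balls of diameter `≤ r`, and `r` tends to `0`. As balls are compact and open and split into
finitely many smaller balls, this is the unique extension of `c` to a Borel measure when `c` is
additive under such splittings. -/
def ballMeasure [Fact (1 < q)] (c : SB B q → ℤ → ℝ≥0∞) : Measure (SB B q) :=
  Measure.mkMetric' fun A => ⨅ (α : SB B q) (N : ℤ) (_ : A = ball α N), c α N

theorem exists_level (α : SB B q) (N : ℤ) :
    ∃ L : ℕ, N ≤ L ∧ ∀ i : ℤ, i < -(L : ℤ) → α.seq i = 0 := by
  obtain ⟨N', hN'⟩ := α.eventually_zero
  refine ⟨(max N (-N')).toNat, ?_, fun i hi => hN' i ?_⟩ <;> omega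

open Classical in
/-- The mass of the ball `K(α, q^N)`. It is determined by `μ(K(0, q^0)) = 1` and
`μ(K(α, q^n)) = B({α}_{-(n+1)}) μ(K(α, q^{n-1}))`: with `L ≥ 0`, `L ≥ N` such that
`K(α, q^L) = K(0, q^L)`, one goes up from `K(0, q^0)` to `K(0, q^L)` and then down
to `K(α, q^N)`. -/
def ballMass (α : SB B q) (N : ℤ) : ℝ :=
  let L : ℤ := Nat.find (exists_level α N)
  (∏ n ∈ Finset.Ioc 0 L, (B (zeroSeq (-(n + 1))) : ℝ)) /
    ∏ n ∈ Finset.Ioc N L, (α.br (n + 1) : ℝ)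

/-- The number `B(α, m, M) = (B({α}_{-(M+m+1)}) - 1) B({α}_{-(M+m)}) ⋯ B({α}_{-(M+2)})`,
for `m ≥ 1`. -/
def bProd (α : SB B q) (m : ℕ) (M : ℤ) : ℝ :=
  ((α.br (M + m + 1) : ℝ) - 1) * ∏ j ∈ Finset.Icc 2 m, (α.br (M + j) : ℝ)

/-- `U(N) = a(N-1) - a(N)`. -/
def jumpU (a : ℤ → ℝ) (N : ℤ) : ℝ := a (N - 1) - a N

/-- `u(α, m, M) = B(α, m, M)⁻¹ U(M+m)`. -/
def jumpRate (a : ℤ → ℝ) (α : SB B q) (m : ℕ) (M : ℤ) : ℝ :=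
  (bProd α m M)⁻¹ * jumpU a (M + m)

/-- `exp {-(a(M) + u(α, 1, M)) t}`. -/
def decay (a : ℤ → ℝ) (t : ℝ) (α : SB B q) (M : ℤ) : ℝ :=
  Real.exp (-(a M + jumpRate a α 1 M) * t)

/-- The probability that the process is in the ball `K(α, q^M)` at time `t` when it starts in
this ball:
`∑_{n ≥ 0} (B({α}_{-(M+n+2)}) ⋯ B({α}_{-(M+2)}))⁻¹ (B({α}_{-(M+n+2)}) - 1)
  exp {-(a(M+n) + u(α, 1, M+n)) t}`. -/
def stayProb (a : ℤ → ℝ) (t : ℝ) (α : SB B q) (M : ℤ) : ℝ :=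
  ∑' n : ℕ, (∏ j ∈ Finset.range (n + 1), (α.br (M + j + 2) : ℝ))⁻¹ *
    ((α.br (M + n + 2) : ℝ) - 1) * decay a t α (M + n)

/-- The transition probability from the ball `K(α, q^M)` to a ball `K(β, q^M)`
with `ρ(α, β) = q^{M+k}`, `k ≥ 1`. -/
def moveProb (a : ℤ → ℝ) (t : ℝ) (α β : SB B q) (k : ℕ) (M : ℤ) : ℝ :=
  (bProd β k M)⁻¹ * (α.br (M + k + 1) : ℝ)⁻¹ * ((α.br (M + k + 1) : ℝ) - 1) *
    (stayProb a t α (M + k) - decay a t α (M + k - 1))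

open Classical in
/-- `P(α, K(β, q^M), t)`. If `ρ(α, β) > q^M` then `ρ(α, β) = q^{M+k}`
with `M + k = -i₀`. -/
def transProb [Fact (1 < q)] (a : ℤ → ℝ) (t : ℝ) (α β : SB B q) (M : ℤ) : ℝ :=
  if β ∈ ball α M then stayProb a t α M
  else moveProb a t α β (-firstDiff α β - M).toNat M

end SB

variable (B q) in
/-- The Borel measure `μ` on `𝕊_B`. -/
def mu [Fact (1 < q)] : Measure (SB B q) :=
  SB.ballMeasure fun α N => ENNReal.ofReal (α.ballMass N)

/-- The transition kernel: `P(η, ·, t)` is the Borel measure with the given values on balls. -/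
def kernelP [Fact (1 < q)] (a : ℤ → ℝ) (t : ℝ) (η : SB B q) : Measure (SB B q) :=
  SB.ballMeasure fun β N => ENNReal.ofReal (SB.transProb a t η β N)

variable (B q) in
/-- The real Hilbert space `L²(𝕊_B, μ)`. -/
abbrev L2 [Fact (1 < q)] : Type := Lp ℝ 2 (mu B q)

/-- `T` is the operator in `L²(𝕊_B, μ)` given by the kernel `P(η, dξ, t)`, that is
`(T f)(η) = ∫ f(ξ) P(η, dξ, t)` for `μ`-almost all `η`, for all `f ∈ L²(𝕊_B, μ)`. -/
def HasKernel [Fact (1 < q)] (a : ℤ → ℝ) (t : ℝ) (T : L2 B q →L[ℝ] L2 B q) : Prop :=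
  ∀ f : L2 B q, ∀ᵐ η ∂(mu B q), Integrable f (kernelP a t η) ∧
    T f η = ∫ ξ, f ξ ∂(kernelP a t η)

variable (B q) in
open Classical in
/-- The operators `T_t`: the bounded operator in `L²(𝕊_B, μ)` given by the kernel
`P(η, dξ, t)`. It is unique since its values are prescribed. (The zero operator in the last
line is a mere placeholder for `t` without such an operator, such as negative `t`.) -/
def semigroupT [Fact (1 < q)] (a : ℤ → ℝ) (t : ℝ) : L2 B q →L[ℝ] L2 B q :=
  if h : ∃ T : L2 B q →L[ℝ] L2 B q, HasKernel a t T then h.choose else 0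

section Generator

variable {E : Type*} [NormedAddCommGroup E] [NormedSpace ℝ E]

/-- The domain of the operator `H` with `H f = lim_{t ↓ 0} t⁻¹ (f - T_t f)`: the vectors for
which the limit exists in norm. -/
def negGeneratorDomain (T : ℝ → E →L[ℝ] E) : Submodule ℝ E where
  carrier := {f | ∃ g, Tendsto (fun t : ℝ => t⁻¹ • (f - T t f)) (𝓝[>] 0) (𝓝 g)}
  zero_mem' := ⟨0, by simp⟩
  add_mem' := by
    rintro f₁ f₂ ⟨g₁, h₁⟩ ⟨g₂, h₂⟩
    refine ⟨g₁ + g₂, (h₁.add h₂).congr fun t => ?_⟩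
    rw [map_add, ← smul_add]
    congr 1
    abel
  smul_mem' := by
    rintro c f ⟨g, h⟩
    refine ⟨c • g, (h.const_smul c).congr fun t => ?_⟩
    rw [map_smul, ← smul_sub, smul_comm]

theorem negGenerator_spec (T : ℝ → E →L[ℝ] E) (f : negGeneratorDomain T) :
    Tendsto (fun t : ℝ => t⁻¹ • ((f : E) - T t f)) (𝓝[>] 0) (𝓝 f.2.choose) :=
  f.2.choose_spec

/-- The (unbounded) operator `H` with `H f = lim_{t ↓ 0} t⁻¹ (f - T_t f)` on the domain of
all `f` for which the limit exists in norm; `-H` is the generator of `T`. -/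
def negGenerator (T : ℝ → E →L[ℝ] E) : E →ₗ.[ℝ] E where
  domain := negGeneratorDomain T
  toFun :=
    { toFun := fun f => f.2.choose
      map_add' := fun f₁ f₂ => by
        refine tendsto_nhds_unique (negGenerator_spec T (f₁ + f₂))
          (((negGenerator_spec T f₁).add (negGenerator_spec T f₂)).congr fun t => ?_)
        rw [Submodule.coe_add, map_add, ← smul_add]
        congr 1
        abel
      map_smul' := fun c f => by
        refine tendsto_nhds_unique (negGenerator_spec T (c • f))
          (((negGenerator_spec T f).const_smul c).congr fun t => ?_)
        rw [Submodule.coe_smul, map_smul, ← smul_sub, smul_comm] }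

end Generator

variable (B q) in
/-- The operator `H` in `L²(𝕊_B, μ)`, with `T_t = e^{-Ht}`. -/
def opH [Fact (1 < q)] (a : ℤ → ℝ) : L2 B q →ₗ.[ℝ] L2 B q :=
  negGenerator (semigroupT B q a)

variable (B q) in
/-- `D₀`, the linear span in `L²(𝕊_B, μ)` of the indicator functions of all balls. -/
def spanBalls [Fact (1 < q)] : Submodule ℝ (L2 B q) :=
  Submodule.span ℝ {f : L2 B q | ∃ (α : SB B q) (N : ℤ),
    f =ᵐ[mu B q] (SB.ball α N).indicator fun _ => (1 : ℝ)}

end Multibranch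

end

namespace Multibranch

variable {B : FinSeq → ℕ} {q : ℝ}

/-! The operators `T_t` are diagonalised by Haar-like functions. Subtracting from the indicator of a
ball its average over the parent ball gives a function with `T_t h = exp(-λt) h`, where `λ = a(M) +
u(β,1,M)`; this is `semigroupT_haarLp`. It rests on one identity, `transProb_succ`: the transition
probability into a ball is its uniform share of that into the parent ball, plus the decay factor
times the Haar function. The same identity makes the transition probabilities additive over the
children of a ball and shows that `μ` is excessive for the kernel, so that each `T_t` is an `L²`
contraction. That the prescribed values really are the values of the constructed measures on balls
is `IsBallContent.ballMeasure_ball`, a compactness argument.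

The rest is operator theory. Let a family of contractions have eigenvectors `e i` with multipliers
`exp(-l i t)`, `l i ≥ 0`, and dense span. Then `1 + H` is bounded below, and its range over the
closure of the graph on the span is closed and contains every `e i`, so it is everything; hence that
closure is the whole graph of `H` (`graph_eq_closure_eigenGraph`). The semigroup law is not needed.

Finally, a ball indicator is a telescoping `L²`-sum of Haar functions on the increasing balls around
it (`hasSum_haarLp`). This gives density, and since the rates along the sum are bounded, ball
indicators lie in the domain (`ballLp_mem_domain`). -/

theorem initialPart_congr {s s' : ℤ → ℕ} {h : ∃ N : ℤ, ∀ i ≤ N, s i = 0}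
    {h' : ∃ N : ℤ, ∀ i ≤ N, s' i = 0} {k : ℤ} (H : ∀ i ≤ k, s i = s' i) :
    initialPart s h k = initialPart s' h' k := by
  unfold initialPart
  congr 1
  apply Subtype.ext
  funext i
  exact H i i.2

/-! ### Ultrametric geometry of balls and their children -/

namespace SB

theorem br_congr' {α β : SB B q} {n : ℤ} (h : ∀ i ≤ -n, β.seq i = α.seq i) :
    β.br n = α.br n := by
  unfold br
  rw [initialPart_congr h]

section Balls

variable [hq : Fact (1 < q)]

theorem mem_ball_iff {α β : SB B q} {N : ℤ} :
    β ∈ ball α N ↔ ∀ i < -N, β.seq i = α.seq i := by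
  have hq1 : 1 < q := hq.out
  have hq0 : 0 < q := zero_lt_one.trans hq1
  change rho β α ≤ q ^ N ↔ _
  by_cases h : β = α
  · subst h
    simp [rho_self, (zpow_pos hq0 N).le]
  · rw [rho, if_neg h, zpow_le_zpow_iff_right₀ hq1]
    constructor
    · intro hle i hi
      by_contra hne
      have := firstDiff_le hne
      omega
    · intro H
      by_contra hlt
      exact firstDiff_spec h (H _ (by omega))

theorem mem_ball_self (α : SB B q) (N : ℤ) : α ∈ ball α N := mem_ball_iff.2 fun _ _ => rfl

theorem mem_ball_comm {α β : SB B q} {N : ℤ} : β ∈ ball α N ↔ α ∈ ball β N := by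
  simp only [mem_ball_iff, eq_comm]

theorem mem_ball_trans {α β γ : SB B q} {N : ℤ} (h : β ∈ ball α N) (h' : γ ∈ ball β N) :
    γ ∈ ball α N := by
  rw [mem_ball_iff] at *
  exact fun i hi => (h' i hi).trans (h i hi)

theorem mem_ball_congr {α β γ : SB B q} {N : ℤ} (h : β ∈ ball α N) :
    γ ∈ ball β N ↔ γ ∈ ball α N :=
  ⟨mem_ball_trans h, mem_ball_trans (mem_ball_comm.1 h)⟩

theorem ball_congr {α β : SB B q} {N : ℤ} (h : β ∈ ball α N) : ball β N = ball α N :=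
  Set.ext fun _ => mem_ball_congr h

theorem ball_mono (α : SB B q) {M N : ℤ} (h : M ≤ N) : ball α M ⊆ ball α N := by
  intro β hβ
  rw [mem_ball_iff] at *
  exact fun i hi => hβ i (by omega)

theorem br_congr {α β : SB B q} {N n : ℤ} (h : β ∈ ball α N) (hn : N < n) :
    β.br n = α.br n :=
  br_congr' fun i hi => mem_ball_iff.1 h i (by omega)

theorem isOpen_ball (α : SB B q) (N : ℤ) : IsOpen (ball α N) := by
  have hq0 : 0 < q := zero_lt_one.trans hq.out
  rw [Metric.isOpen_iff]
  intro β hβ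
  refine ⟨q ^ N, zpow_pos hq0 N, fun γ hγ => ?_⟩
  exact mem_ball_trans hβ (Metric.ball_subset_closedBall hγ)

theorem measurableSet_ball (α : SB B q) (N : ℤ) : MeasurableSet (ball α N) :=
  (isOpen_ball α N).measurableSet

theorem ediam_ball_le (α : SB B q) (N : ℤ) :
    Metric.ediam (ball α N) ≤ ENNReal.ofReal (q ^ N) := by
  refine Metric.ediam_le fun x hx y hy => ?_
  rw [edist_dist]
  refine ENNReal.ofReal_le_ofReal ?_
  have : x ∈ ball y N := (mem_ball_congr hy).2 hx
  exact this

/-- The point of `K(α, q^(M+1))` whose coordinate at the first free index `-(M+1)` is `v`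
and whose later coordinates vanish. -/
def child (hB : ∀ s, 2 ≤ B s) (α : SB B q) (M : ℤ) (v : Fin (α.br (M + 2))) : SB B q where
  seq i := if i < -(M + 1) then α.seq i else if i = -(M + 1) then v else 0
  eventually_zero := by
    obtain ⟨N, hN⟩ := α.eventually_zero
    refine ⟨min N (-(M + 2)), fun i hi => ?_⟩
    rw [if_pos (by omega)]
    exact hN i (by omega)
  lt_branching k := by
    rcases lt_trichotomy (k + 1) (-(M + 1)) with h | h | h
    · rw [if_pos h]
      convert α.lt_branching k using 2
      exact initialPart_congr fun i hi => if_pos (by omega)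
    · rw [if_neg (by omega), if_pos h]
      convert v.2 using 1
      unfold br
      have hk : k = -(M + 2) := by omega
      subst hk
      congr 1
      exact initialPart_congr fun i hi => if_pos (by omega)
    · rw [if_neg (by omega), if_neg (by omega)]
      exact lt_of_lt_of_le two_pos (hB _)

theorem child_mem (hB : ∀ s, 2 ≤ B s) (α : SB B q) (M : ℤ) (v : Fin (α.br (M + 2))) :
    child hB α M v ∈ ball α (M + 1) :=
  mem_ball_iff.2 fun i hi => if_pos (by omega)

omit hq in
theorem child_seq (hB : ∀ s, 2 ≤ B s) (α : SB B q) (M : ℤ) (v : Fin (α.br (M + 2))) :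
    (child hB α M v).seq (-(M + 1)) = v := by
  simp [child]

theorem mem_ball_child_iff (hB : ∀ s, 2 ≤ B s) {α β : SB B q} {M : ℤ} {v : Fin (α.br (M + 2))} :
    β ∈ ball (child hB α M v) M ↔ β ∈ ball α (M + 1) ∧ β.seq (-(M + 1)) = v := by
  constructor
  · intro h
    refine ⟨mem_ball_trans (child_mem hB α M v) (ball_mono _ (by omega) h), ?_⟩
    rw [← child_seq hB α M v]
    exact mem_ball_iff.1 h _ (by omega)
  · rintro ⟨h, h'⟩
    refine mem_ball_iff.2 fun i hi => ?_
    rcases eq_or_ne i (-(M + 1)) with rfl | hne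
    · rw [child_seq, h']
    · rw [mem_ball_iff.1 h i (by omega), mem_ball_iff.1 (child_mem hB α M v) i (by omega)]

theorem seq_lt_of_mem {α β : SB B q} {M : ℤ} (h : β ∈ ball α (M + 1)) :
    β.seq (-(M + 1)) < α.br (M + 2) := by
  rw [← br_congr h (show M + 1 < M + 2 by omega)]
  have := β.lt_branching (-(M + 2))
  rwa [show -(M + 2) + 1 = -(M + 1) by ring] at this

theorem ball_eq_iUnion_child (hB : ∀ s, 2 ≤ B s) (α : SB B q) (M : ℤ) :
    ball α (M + 1) = ⋃ v : Fin (α.br (M + 2)), ball (child hB α M v) M := by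
  ext β
  simp only [Set.mem_iUnion, mem_ball_child_iff]
  constructor
  · exact fun h => ⟨⟨_, seq_lt_of_mem h⟩, h, rfl⟩
  · rintro ⟨_, h, _⟩
    exact h

theorem sum_child_mem (hB : ∀ s, 2 ≤ B s) {A : Type*} [AddCommMonoid A] (α β : SB B q) (M : ℤ)
    (x : A) [∀ v, Decidable (β ∈ ball (child hB α M v) M)] [Decidable (β ∈ ball α (M + 1))] :
    ∑ v : Fin (α.br (M + 2)), (if β ∈ ball (child hB α M v) M then x else 0) =
      if β ∈ ball α (M + 1) then x else 0 := by
  by_cases h : β ∈ ball α (M + 1)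
  · rw [if_pos h, Finset.sum_eq_single ⟨_, seq_lt_of_mem h⟩]
    · rw [if_pos ((mem_ball_child_iff hB).2 ⟨h, rfl⟩)]
    · intro v _ hv
      refine if_neg fun hm => hv ?_
      exact Fin.ext ((mem_ball_child_iff hB).1 hm).2.symm
    · simp
  · rw [if_neg h]
    refine Finset.sum_eq_zero fun v _ => if_neg fun hm => h ((mem_ball_child_iff hB).1 hm).1

/-- Every ball has at least two children, so a larger ball contains points that differ at a
coordinate fixed in the smaller one. Hence a ball, as a set, determines its radius exponent. -/
theorem le_of_ball_subset (hB : ∀ s, 2 ≤ B s) {α β : SB B q} {M N : ℤ}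
    (h : ball α N ⊆ ball β M) : N ≤ M := by
  by_contra hlt
  obtain ⟨L, rfl⟩ : ∃ L, N = L + 1 := ⟨N - 1, by ring⟩
  have h2 : 2 ≤ α.br (L + 2) := hB _
  have hv : ∀ v : Fin (α.br (L + 2)), (v : ℕ) = β.seq (-(L + 1)) := fun v => by
    rw [← child_seq hB α L v]
    exact mem_ball_iff.1 (h (child_mem hB α L v)) _ (by omega)
  have h0 := hv ⟨0, by omega⟩
  have h1 := hv ⟨1, by omega⟩
  simp only at h0 h1
  omega

theorem ball_eq_iff (hB : ∀ s, 2 ≤ B s) {α β : SB B q} {M N : ℤ} :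
    ball α N = ball β M ↔ N = M ∧ α ∈ ball β M := by
  constructor
  · intro h
    exact ⟨le_antisymm (le_of_ball_subset hB h.le) (le_of_ball_subset hB h.ge),
      h ▸ mem_ball_self α N⟩
  · rintro ⟨rfl, h⟩
    exact ball_congr h

end Balls

end SB

end Multibranch

/-! ### Extending additive ball contents to Borel measures -/

namespace Multibranch

variable {B : FinSeq → ℕ} {q : ℝ}

namespace SB

variable [hq : Fact (1 < q)]

/-- Coordinate `i` is constant along the centres from index `(i + N + 1).toNat` on; the limit point
takes that stable value. -/
theorem exists_mem_nested_balls (x : ℕ → SB B q) (N : ℤ)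
    (hx : ∀ n : ℕ, x (n + 1) ∈ ball (x n) (N - n)) : ∃ y : SB B q, ∀ n : ℕ, y ∈ ball (x n) (N - n) := by
  have hmn : ∀ n k : ℕ, x (n + k) ∈ ball (x n) (N - n) := by
    intro n k
    induction k with
    | zero => exact mem_ball_self _ _
    | succ k ih =>
      exact mem_ball_trans ih (ball_mono _ (by push_cast; omega) (hx (n + k)))
  have key : ∀ (n : ℕ) (i : ℤ), i < -(N - n) →
      (x (i + N + 1).toNat).seq i = (x n).seq i := by
    intro n i hi
    obtain ⟨k, rfl⟩ : ∃ k, n = (i + N + 1).toNat + k := ⟨n - (i + N + 1).toNat, by omega⟩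
    exact (mem_ball_iff.1 (hmn (i + N + 1).toNat k) i (by omega)).symm
  have h0 : ∃ M : ℤ, ∀ i ≤ M, (fun i : ℤ => (x (i + N + 1).toNat).seq i) i = 0 := by
    obtain ⟨M, hM⟩ := (x 0).eventually_zero
    refine ⟨min M (-N - 1), fun i hi => ?_⟩
    simp only
    rw [key 0 i (by push_cast; omega)]
    exact hM i (by omega)
  refine ⟨⟨fun i => (x (i + N + 1).toNat).seq i, h0, fun k => ?_⟩,
    fun n => mem_ball_iff.2 fun i hi => key n i hi⟩
  convert (x (k + 1 + N + 1).toNat).lt_branching k using 2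
  exact initialPart_congr fun i hi => key _ i (by omega)

/-- A set function on balls which is additive under splitting a ball into its children. -/
structure IsBallContent (hB : ∀ s, 2 ≤ B s) (c : SB B q → ℤ → ℝ≥0∞) : Prop where
  congr : ∀ {α β : SB B q} {N : ℤ}, β ∈ ball α N → c β N = c α N
  sum_child : ∀ (α : SB B q) (N : ℤ),
    ∑ v : Fin (α.br (N + 2)), c (child hB α N v) N = c α (N + 1)

open Classical in
/-- The content of `K(γ, q^L) ∩ K(β, q^N)`. -/
noncomputable def interContent (c : SB B q → ℤ → ℝ≥0∞) (γ : SB B q) (L : ℤ) (β : SB B q) (N : ℤ) :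
    ℝ≥0∞ :=
  if γ ∈ ball β (max N L) then (if N ≤ L then c β N else c γ L) else 0

variable {hB : ∀ s, 2 ≤ B s} {c : SB B q → ℤ → ℝ≥0∞}

/-- If the parent ball has level at most `L`, this is additivity of `c` or a sum of zeros; otherwise
at most one child meets `K(γ, q^L)`, and it contains that ball. -/
theorem IsBallContent.sum_interContent (hc : IsBallContent hB c) (γ : SB B q) (L : ℤ)
    (β : SB B q) (N : ℤ) :
    ∑ v : Fin (β.br (N + 2)), interContent c γ L (child hB β N v) N =
      interContent c γ L β (N + 1) := by
  classical
  rcases le_or_gt (N + 1) L with h | h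
  · unfold interContent
    simp only [if_pos h, if_pos (show N ≤ L by omega), max_eq_right h,
      max_eq_right (show N ≤ L by omega)]
    have : ∀ v, γ ∈ ball (child hB β N v) L ↔ γ ∈ ball β L := fun v =>
      mem_ball_congr (ball_mono _ h (child_mem hB β N v))
    simp only [this]
    split_ifs
    · exact hc.sum_child β N
    · simp
  · have : ∀ v, interContent c γ L (child hB β N v) N =
        if γ ∈ ball (child hB β N v) N then c γ L else 0 := by
      intro v
      unfold interContent
      rw [max_eq_left (by omega)]
      split_ifs with h1 h2
      · obtain rfl : N = L := by omega
        exact (hc.congr h1).symm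
      · rfl
      · rfl
    simp only [this]
    rw [sum_child_mem hB]
    unfold interContent
    rw [max_eq_left (by omega), if_neg (show ¬ N + 1 ≤ L by omega)]

theorem IsBallContent.interContent_le (hc : IsBallContent hB c) (γ : SB B q) (L : ℤ)
    (β : SB B q) (N : ℤ) : interContent c γ L β N ≤ c γ L := by
  have hmono : ∀ (n : ℕ), ∀ β : SB B q, c β N ≤ c β (N + n) := by
    intro n
    induction n with
    | zero => simp
    | succ n ih =>
      intro β
      refine (ih β).trans ?_
      push_cast
      rw [← add_assoc, ← hc.sum_child β (N + n)]
      have hβ : β ∈ ball (child hB β (N + n) ⟨_, seq_lt_of_mem (mem_ball_self β _)⟩) (N + n) :=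
        (mem_ball_child_iff hB).2 ⟨mem_ball_self _ _, rfl⟩
      rw [hc.congr hβ]
      exact Finset.single_le_sum (f := fun v => c (child hB β (N + n) v) (N + n))
        (fun _ _ => zero_le) (Finset.mem_univ _)
  unfold interContent
  split_ifs with h1 h2
  · rw [max_eq_right h2] at h1
    rw [hc.congr h1]
    have := hmono (L - N).toNat β
    rwa [show N + ((L - N).toNat : ℤ) = L by omega] at this
  · exact le_rfl
  · exact zero_le

/-- Compactness by descent. If the cover had too little content, some child would inherit the
deficit, and so on down to a point. That point lies in a covering ball, and a small ball inside a
covering ball has no deficit. -/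
theorem IsBallContent.le_tsum (hc : IsBallContent hB c) {ι : Type*} (γ : ι → SB B q) (L : ι → ℤ)
    {α : SB B q} {N : ℤ} (hcov : ball α N ⊆ ⋃ i, ball (γ i) (L i)) :
    c α N ≤ ∑' i, c (γ i) (L i) := by
  set F : SB B q → ℤ → ℝ≥0∞ := fun β n => ∑' i, interContent c (γ i) (L i) β n with hF
  have hFsum : ∀ β n, ∑ v : Fin (β.br (n + 2)), F (child hB β n v) n = F β (n + 1) := by
    intro β n
    simp only [hF]
    rw [← Summable.tsum_finsetSum fun _ _ => ENNReal.summable]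
    exact tsum_congr fun i => hc.sum_interContent _ _ _ _
  have hstep : ∀ β n, F β (n + 1) < c β (n + 1) → ∃ β' ∈ ball β (n + 1), F β' n < c β' n := by
    intro β n h
    by_contra! hcon
    refine h.not_ge ?_
    rw [← hFsum, ← hc.sum_child]
    exact Finset.sum_le_sum fun v _ => hcon _ (child_mem hB β n v)
  by_contra! hlt
  have hα : F α N < c α N :=
    (ENNReal.tsum_le_tsum fun i => hc.interContent_le _ _ _ _).trans_lt hlt
  choose! next hnext hnext' using hstep
  -- The centres of the successive balls with a deficit.
  let x : ℕ → SB B q := fun n => Nat.rec α (fun n y => next y (N - n - 1)) n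
  have hxs : ∀ n, x (n + 1) = next (x n) (N - n - 1) := fun _ => rfl
  have hx : ∀ n : ℕ, F (x n) (N - n) < c (x n) (N - n) := by
    intro n
    induction n with
    | zero =>
      rw [Nat.cast_zero, sub_zero]
      exact hα
    | succ n ih =>
      rw [hxs]
      push_cast
      rw [← sub_sub]
      exact hnext' _ _ (by rwa [sub_add_cancel])
  obtain ⟨y, hy⟩ := exists_mem_nested_balls x N fun n => by
    have := hnext (x n) (N - n - 1) (by rw [sub_add_cancel]; exact hx n)
    rwa [sub_add_cancel] at this
  obtain ⟨i, hi⟩ := Set.mem_iUnion.1 (hcov (by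
    have := hy 0
    rw [Nat.cast_zero, sub_zero] at this
    exact this))
  -- Deep enough that the `n`-th ball lies in the covering ball `i`, whose term alone is then the
  -- full content.
  set n := (N - L i).toNat
  have hn : N - n ≤ L i := by omega
  refine (hx n).not_ge ?_
  refine le_trans (le_of_eq ?_) (ENNReal.le_tsum i)
  unfold interContent
  rw [max_eq_right hn, if_pos hn, if_pos]
  exact mem_ball_trans (ball_mono _ hn (hy n)) (mem_ball_comm.1 hi)

/-- The outer measure built at scale `r = 1` already dominates every measure bounded by `c` on
balls. This lets excessiveness of `μ` be checked on balls alone. -/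
theorem le_ballMeasure {ν : Measure (SB B q)} (h : ∀ α N, ν (ball α N) ≤ c α N) :
    ν ≤ ballMeasure c := by
  refine Measure.le_iff.2 fun s hs => ?_
  have : ν.toOuterMeasure ≤ OuterMeasure.mkMetric' fun A => ⨅ (α : SB B q) (N : ℤ)
      (_ : A = ball α N), c α N := by
    refine le_iSup₂_of_le 1 one_pos (OuterMeasure.mkMetric'.le_pre.2 fun A _ => ?_)
    refine le_iInf fun α => le_iInf fun N => le_iInf fun hA => ?_
    rw [hA]
    exact h α N
  refine (this s).trans ?_
  rw [ballMeasure, Measure.mkMetric', toMeasure_apply _ _ hs]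

theorem IsBallContent.le_ballMeasure_ball (hc : IsBallContent hB c) (α : SB B q) (N : ℤ) :
    c α N ≤ ballMeasure c (ball α N) := by
  rw [ballMeasure, Measure.mkMetric', toMeasure_apply _ _ (measurableSet_ball α N)]
  refine le_trans ?_ ((le_iSup₂_of_le (f := fun (r : ℝ≥0∞) (_ : r > 0) =>
    OuterMeasure.mkMetric'.pre (fun A => ⨅ (α : SB B q) (N : ℤ)
      (_ : A = ball α N), c α N) r) 1 one_pos le_rfl : _ ≤ _) _)
  rw [OuterMeasure.mkMetric'.pre, OuterMeasure.boundedBy, OuterMeasure.ofFunction_apply]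
  refine le_iInf₂ fun t ht => ?_
  -- A cover with a nonempty member that is not a ball costs `⊤`, so only covers by balls matter.
  by_cases htop : ∃ i, (t i).Nonempty ∧ ∀ γ L, t i ≠ ball γ L
  · obtain ⟨i, hi, hne⟩ := htop
    refine le_trans ?_ (ENNReal.le_tsum i)
    refine le_iSup_of_le hi (le_iInf fun _ => ?_)
    simp [hne]
  push Not at htop
  choose γ L hγ using fun i : {i // (t i).Nonempty} => htop i.1 i.2
  refine (hc.le_tsum (α := α) (N := N) γ L ?_).trans ?_
  · intro x hx
    obtain ⟨i, hi⟩ := Set.mem_iUnion.1 (ht hx)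
    refine Set.mem_iUnion.2 ⟨⟨i, ⟨x, hi⟩⟩, ?_⟩
    rw [← hγ]
    exact hi
  · refine le_trans ?_ (ENNReal.tsum_comp_le_tsum_of_injective
      (Subtype.val_injective : Function.Injective (Subtype.val : {i // (t i).Nonempty} → ℕ)) _)
    refine ENNReal.tsum_le_tsum fun i => ?_
    refine le_iSup_of_le i.2 (le_iInf fun _ => le_iInf fun α => le_iInf fun N => le_iInf fun h => ?_)
    rw [hγ i, ball_eq_iff hB] at h
    rw [h.1]
    exact (hc.congr h.2).le

theorem IsBallContent.ballMeasure_ball_le (hc : IsBallContent hB c) (α : SB B q) (N : ℤ) :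
    ballMeasure c (ball α N) ≤ c α N := by
  have hq1 : 1 < q := hq.out
  have hq0 : 0 < q := zero_lt_one.trans hq1
  rw [ballMeasure, Measure.mkMetric', toMeasure_apply _ _ (measurableSet_ball α N),
    OuterMeasure.mkMetric']
  simp only [OuterMeasure.iSup_apply]
  refine iSup₂_le fun r hr => ?_
  -- After `n` splittings the pieces have diameter at most `r` and are admissible; additivity keeps
  -- the total equal to `c β M`.
  have key : ∀ (n : ℕ) (M : ℤ), ENNReal.ofReal (q ^ (M - n)) ≤ r → ∀ β : SB B q,
      OuterMeasure.mkMetric'.pre (fun A => ⨅ (α : SB B q) (N : ℤ) (_ : A = ball α N), c α N) r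
        (ball β M) ≤ c β M := by
    intro n
    induction n with
    | zero =>
      intro M hM β
      refine (OuterMeasure.mkMetric'.pre_le ((ediam_ball_le β M).trans (by simpa using hM))).trans ?_
      exact iInf_le_of_le β (iInf_le_of_le M (iInf_le _ rfl))
    | succ n ih =>
      intro M hM β
      obtain ⟨M, rfl⟩ : ∃ L, M = L + 1 := ⟨M - 1, by ring⟩
      rw [ball_eq_iUnion_child hB]
      refine (measure_iUnion_fintype_le _ _).trans ?_
      rw [← hc.sum_child]
      exact Finset.sum_le_sum fun v _ => ih M (by convert hM using 3; push_cast; ring) _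
  have : Tendsto (fun n : ℕ => ENNReal.ofReal (q ^ (N - n))) atTop (𝓝 0) := by
    rw [← ENNReal.ofReal_zero]
    refine (ENNReal.continuous_ofReal.tendsto 0).comp ?_
    have h := (tendsto_pow_atTop_nhds_zero_of_lt_one (inv_nonneg.2 hq0.le)
      (inv_lt_one_of_one_lt₀ hq1)).const_mul (q ^ N)
    rw [mul_zero] at h
    refine h.congr fun n => ?_
    rw [zpow_sub₀ hq0.ne', zpow_natCast, inv_pow, div_eq_mul_inv]
  obtain ⟨n, hn⟩ := (this.eventually (Iic_mem_nhds hr)).exists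
  exact key n N hn α

theorem IsBallContent.ballMeasure_ball (hc : IsBallContent hB c) (α : SB B q) (N : ℤ) :
    ballMeasure c (ball α N) = c α N :=
  (hc.ballMeasure_ball_le α N).antisymm (hc.le_ballMeasure_ball α N)

end SB

end Multibranch

/-! ### The masses of balls and the measure `μ` -/

namespace Multibranch

variable {B : FinSeq → ℕ} {q : ℝ}

namespace SB

theorem Ioc_int_eq_insert_left {M N : ℤ} (h : M < N) :
    Finset.Ioc M N = insert (M + 1) (Finset.Ioc (M + 1) N) := by
  ext i
  simp only [Finset.mem_Ioc, Finset.mem_insert]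
  omega

theorem Ioc_int_eq_insert_right {M N : ℤ} (h : M ≤ N) :
    Finset.Ioc M (N + 1) = insert (N + 1) (Finset.Ioc M N) := by
  ext i
  simp only [Finset.mem_Ioc, Finset.mem_insert]
  omega

theorem br_pos (hB : ∀ s, 2 ≤ B s) (α : SB B q) (n : ℤ) : (0 : ℝ) < α.br n :=
  Nat.cast_pos.2 (lt_of_lt_of_le two_pos (hB _))

theorem two_le_br (hB : ∀ s, 2 ≤ B s) (α : SB B q) (n : ℤ) : (2 : ℝ) ≤ α.br n := by
  exact_mod_cast hB _

/-- Any admissible level may replace the least one: above it the initial parts are zero, so raising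
the level multiplies numerator and denominator by the same factor. -/
theorem ballMass_eq (hB : ∀ s, 2 ≤ B s) (α : SB B q) (N : ℤ) (L : ℕ) (hNL : N ≤ L)
    (hL : ∀ i : ℤ, i < -(L : ℤ) → α.seq i = 0) :
    ballMass α N = (∏ n ∈ Finset.Ioc 0 (L : ℤ), (B (zeroSeq (-(n + 1))) : ℝ)) /
      ∏ n ∈ Finset.Ioc N (L : ℤ), (α.br (n + 1) : ℝ) := by
  classical
  have hle := Nat.find_min' (exists_level α N) ⟨hNL, hL⟩
  obtain ⟨h1, h2⟩ := Nat.find_spec (exists_level α N)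
  have key : ∀ k L : ℕ, N ≤ L → (∀ i : ℤ, i < -(L : ℤ) → α.seq i = 0) →
      (∏ n ∈ Finset.Ioc 0 ((L + k : ℕ) : ℤ), (B (zeroSeq (-(n + 1))) : ℝ)) /
        ∏ n ∈ Finset.Ioc N ((L + k : ℕ) : ℤ), (α.br (n + 1) : ℝ) =
      (∏ n ∈ Finset.Ioc 0 (L : ℤ), (B (zeroSeq (-(n + 1))) : ℝ)) /
        ∏ n ∈ Finset.Ioc N (L : ℤ), (α.br (n + 1) : ℝ) := by
    intro k L hNL hL
    induction k with
    | zero => rfl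
    | succ k ih =>
      rw [← ih, ← add_assoc, Nat.cast_succ, Ioc_int_eq_insert_right (by omega),
        Ioc_int_eq_insert_right (by omega), Finset.prod_insert (by simp),
        Finset.prod_insert (by simp)]
      have : zeroSeq (-(((L + k : ℕ) : ℤ) + 1 + 1)) =
          initialPart α.seq α.eventually_zero (-(((L + k : ℕ) : ℤ) + 1 + 1)) :=
        initialPart_congr (s := fun _ => 0) (h := ⟨0, fun _ _ => rfl⟩)
          fun i hi => (hL i (by push_cast at hi; omega)).symm
      rw [this]
      exact mul_div_mul_left _ _ (br_pos hB α _).ne'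
  obtain ⟨k, hk⟩ := Nat.exists_eq_add_of_le hle
  have := key k _ h1 h2
  rw [← hk] at this
  exact this.symm

theorem ballMass_succ (hB : ∀ s, 2 ≤ B s) (α : SB B q) (N : ℤ) :
    ballMass α (N + 1) = α.br (N + 2) * ballMass α N := by
  obtain ⟨L, h1, h2⟩ := exists_level α (N + 1)
  rw [ballMass_eq hB α (N + 1) L h1 h2, ballMass_eq hB α N L (by omega) h2,
    Ioc_int_eq_insert_left (show N < L by omega), Finset.prod_insert (by simp),
    show N + 1 + 1 = N + 2 by ring]
  have := (br_pos hB α (N + 2)).ne'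
  field_simp

theorem ballMass_pos (hB : ∀ s, 2 ≤ B s) (α : SB B q) (N : ℤ) : 0 < ballMass α N := by
  unfold ballMass
  refine div_pos (Finset.prod_pos fun n _ => ?_) (Finset.prod_pos fun n _ => br_pos hB _ _)
  exact Nat.cast_pos.2 (lt_of_lt_of_le two_pos (hB _))

section Measure

variable [hq : Fact (1 < q)]

theorem ballMass_congr (hB : ∀ s, 2 ≤ B s) {α β : SB B q} {N : ℤ} (h : β ∈ ball α N) :
    ballMass β N = ballMass α N := by
  obtain ⟨L, h1, h2⟩ := exists_level α N
  obtain ⟨L', h1', h2'⟩ := exists_level β N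
  rw [ballMass_eq hB α N (max L L') (by omega) fun i hi => h2 i (by omega),
    ballMass_eq hB β N (max L L') (by omega) fun i hi => h2' i (by omega)]
  congr 1
  refine Finset.prod_congr rfl fun n hn => ?_
  rw [br_congr h]
  have := (Finset.mem_Ioc.1 hn).1
  omega

theorem isBallContent_ofReal {hB : ∀ s, 2 ≤ B s} {c : SB B q → ℤ → ℝ} (h0 : ∀ α N, 0 ≤ c α N)
    (hcongr : ∀ {α β : SB B q} {N : ℤ}, β ∈ ball α N → c β N = c α N)
    (hsum : ∀ (α : SB B q) (N : ℤ),
      ∑ v : Fin (α.br (N + 2)), c (child hB α N v) N = c α (N + 1)) :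
    IsBallContent hB fun α N => ENNReal.ofReal (c α N) where
  congr h := by rw [hcongr h]
  sum_child α N := by
    rw [← ENNReal.ofReal_sum_of_nonneg fun _ _ => h0 _ _, hsum]

theorem isBallContent_ballMass (hB : ∀ s, 2 ≤ B s) :
    IsBallContent hB fun (α : SB B q) N => ENNReal.ofReal (α.ballMass N) := by
  refine isBallContent_ofReal (fun α N => (ballMass_pos hB α N).le) (ballMass_congr hB)
    fun α N => ?_
  have hb := (br_pos hB α (N + 2)).ne'
  have : ∀ v, ballMass (child hB α N v) N = (α.br (N + 2) : ℝ)⁻¹ * ballMass α (N + 1) := by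
    intro v
    rw [← ballMass_congr hB (child_mem hB α N v), ballMass_succ hB,
      br_congr (child_mem hB α N v) (by omega)]
    field_simp
  simp only [this, Finset.sum_const, Finset.card_univ, Fintype.card_fin, nsmul_eq_mul]
  field_simp

theorem mu_ball (hB : ∀ s, 2 ≤ B s) (α : SB B q) (N : ℤ) :
    mu B q (ball α N) = ENNReal.ofReal (ballMass α N) :=
  (isBallContent_ballMass hB).ballMeasure_ball α N

theorem mu_ball_ne_top (hB : ∀ s, 2 ≤ B s) (α : SB B q) (N : ℤ) : mu B q (ball α N) ≠ ⊤ := by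
  rw [mu_ball hB]
  exact ENNReal.ofReal_ne_top

theorem mu_real_ball (hB : ∀ s, 2 ≤ B s) (α : SB B q) (N : ℤ) :
    (mu B q).real (ball α N) = ballMass α N := by
  rw [Measure.real, mu_ball hB, ENNReal.toReal_ofReal (ballMass_pos hB α N).le]

theorem exists_mem_ball (α β : SB B q) : ∃ L : ℕ, β ∈ ball α L := by
  obtain ⟨L, _, h2⟩ := exists_level α 0
  obtain ⟨L', _, h2'⟩ := exists_level β 0
  refine ⟨max L L', mem_ball_iff.2 fun i hi => ?_⟩
  rw [h2 i (by omega), h2' i (by omega)]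

theorem iUnion_ball (α : SB B q) : ⋃ L : ℕ, ball α L = Set.univ :=
  Set.eq_univ_of_forall fun β => Set.mem_iUnion.2 (exists_mem_ball α β)

theorem monotone_ball (α : SB B q) : Monotone fun L : ℕ => ball α (L : ℤ) :=
  fun _ _ h => ball_mono α (by exact_mod_cast h)

/-- The zero sequence. -/
def zero (hB : ∀ s, 2 ≤ B s) : SB B q where
  seq _ := 0
  eventually_zero := ⟨0, fun _ _ => rfl⟩
  lt_branching _ := lt_of_lt_of_le two_pos (hB _)

end Measure

end SB

end Multibranch

/-! ### Rates, decay factors and staying probabilities -/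

namespace Multibranch

variable {B : FinSeq → ℕ} {q : ℝ}

theorem hasSum_telescope_of_nonneg {f : ℕ → ℝ} (h : ∀ n, f (n + 1) ≤ f n)
    (hf : Tendsto f atTop (𝓝 0)) : HasSum (fun n => f n - f (n + 1)) (f 0) := by
  rw [hasSum_iff_tendsto_nat_of_nonneg fun n => sub_nonneg.2 (h n)]
  simp only [Finset.sum_range_sub']
  simpa using hf.const_sub (f 0)

namespace SB

/-- The rate `a(M) + u(α, 1, M)`. -/
noncomputable def rate (a : ℤ → ℝ) (α : SB B q) (M : ℤ) : ℝ := a M + jumpRate a α 1 M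

theorem decay_eq (a : ℤ → ℝ) (t : ℝ) (α : SB B q) (M : ℤ) :
    decay a t α M = Real.exp (-(rate a α M * t)) := by
  rw [decay, rate, neg_mul]

theorem rate_eq (a : ℤ → ℝ) (α : SB B q) (M : ℤ) :
    rate a α M = a M + ((α.br (M + 2) : ℝ) - 1)⁻¹ * (a M - a (M + 1)) := by
  simp [rate, jumpRate, bProd, jumpU, add_assoc, one_add_one_eq_two]

/-- The ratio `μ(K(α, q^M)) / μ(K(α, q^(M+n)))`. -/
noncomputable def massRatio (α : SB B q) (M : ℤ) (n : ℕ) : ℝ :=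
  (∏ j ∈ Finset.range n, (α.br (M + j + 2) : ℝ))⁻¹

theorem massRatio_zero (α : SB B q) (M : ℤ) : massRatio α M 0 = 1 := by simp [massRatio]

theorem massRatio_succ (α : SB B q) (M : ℤ) (n : ℕ) :
    massRatio α M (n + 1) = massRatio α M n * (α.br (M + n + 2) : ℝ)⁻¹ := by
  rw [massRatio, massRatio, Finset.prod_range_succ, mul_inv]

theorem massRatio_succ' (α : SB B q) (M : ℤ) (n : ℕ) :
    massRatio α M (n + 1) = (α.br (M + 2) : ℝ)⁻¹ * massRatio α (M + 1) n := by
  rw [massRatio, massRatio, Finset.prod_range_succ', mul_inv, mul_comm]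
  congr 2
  · simp
  · refine Finset.prod_congr rfl fun j _ => ?_
    congr 2
    push_cast
    ring

section Order

variable (hB : ∀ s, 2 ≤ B s)
include hB

theorem massRatio_pos (α : SB B q) (M : ℤ) (n : ℕ) : 0 < massRatio α M n :=
  inv_pos.2 (Finset.prod_pos fun _ _ => br_pos hB _ _)

theorem massRatio_le (α : SB B q) (M : ℤ) (n : ℕ) : massRatio α M n ≤ (1 / 2) ^ n := by
  induction n with
  | zero => simp [massRatio]
  | succ n ih =>
    rw [massRatio_succ, pow_succ]
    refine mul_le_mul ih ?_ (inv_nonneg.2 (br_pos hB _ _).le) (by positivity)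
    rw [one_div]
    exact inv_anti₀ two_pos (two_le_br hB _ _)

theorem massRatio_tendsto (α : SB B q) (M : ℤ) : Tendsto (massRatio α M) atTop (𝓝 0) :=
  squeeze_zero (fun n => (massRatio_pos hB α M n).le) (massRatio_le hB α M)
    (tendsto_pow_atTop_nhds_zero_of_lt_one (by norm_num) (by norm_num))

theorem massRatio_succ_le (α : SB B q) (M : ℤ) (n : ℕ) :
    massRatio α M (n + 1) ≤ massRatio α M n := by
  rw [massRatio_succ]
  refine mul_le_of_le_one_right (massRatio_pos hB α M n).le (inv_le_one_of_one_le₀ ?_)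
  linarith [two_le_br hB α (M + n + 2)]

theorem hasSum_massRatio (α : SB B q) (M : ℤ) :
    HasSum (fun n => massRatio α M n - massRatio α M (n + 1)) 1 := by
  have := hasSum_telescope_of_nonneg (massRatio_succ_le hB α M) (massRatio_tendsto hB α M)
  rwa [massRatio_zero] at this

/-- The weights are successive differences of mass ratios and telescope to total 1, so `stayProb` is
an average of decay factors. -/
theorem stayProb_eq (a : ℤ → ℝ) (t : ℝ) (α : SB B q) (M : ℤ) :
    stayProb a t α M =
      ∑' n : ℕ, (massRatio α M n - massRatio α M (n + 1)) * decay a t α (M + n) := by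
  unfold stayProb
  refine tsum_congr fun n => ?_
  congr 1
  have : massRatio α M n = massRatio α M (n + 1) * α.br (M + n + 2) := by
    rw [massRatio_succ, inv_mul_cancel_right₀ (br_pos hB _ _).ne']
  rw [this]
  unfold massRatio
  ring

end Order

theorem nonneg_of_antitone_tendsto {a : ℤ → ℝ} (ha : ∀ N, a (N + 1) ≤ a N)
    (ha_top : Tendsto a atTop (𝓝 0)) (N : ℤ) : 0 ≤ a N :=
  (antitone_int_of_succ_le ha).le_of_tendsto ha_top N

section Rates

variable (hB : ∀ s, 2 ≤ B s) {a : ℤ → ℝ} (ha : ∀ N, a (N + 1) ≤ a N)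
  (ha_top : Tendsto a atTop (𝓝 0))
include hB ha

theorem le_rate (α : SB B q) (M : ℤ) : a M ≤ rate a α M := by
  rw [rate_eq]
  have := two_le_br hB α (M + 2)
  have h1 := ha M
  have : 0 ≤ ((α.br (M + 2) : ℝ) - 1)⁻¹ * (a M - a (M + 1)) :=
    mul_nonneg (inv_nonneg.2 (by linarith)) (by linarith)
  linarith

include ha_top

theorem rate_nonneg (α : SB B q) (M : ℤ) : 0 ≤ rate a α M :=
  (nonneg_of_antitone_tendsto ha ha_top M).trans (le_rate hB ha α M)

theorem rate_le (α : SB B q) (M : ℤ) : rate a α M ≤ 2 * a M := by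
  rw [rate_eq]
  have h2 := two_le_br hB α (M + 2)
  have h1 := ha M
  have h0 := nonneg_of_antitone_tendsto ha ha_top (M + 1)
  have : ((α.br (M + 2) : ℝ) - 1)⁻¹ * (a M - a (M + 1)) ≤ 1 * (a M - a (M + 1)) :=
    mul_le_mul_of_nonneg_right (inv_le_one_of_one_le₀ (by linarith)) (by linarith)
  linarith

theorem decay_le_one {t : ℝ} (ht : 0 ≤ t) (α : SB B q) (M : ℤ) : decay a t α M ≤ 1 := by
  rw [decay_eq]
  exact Real.exp_le_one_iff.2 (neg_nonpos.2 (mul_nonneg (rate_nonneg hB ha ha_top α M) ht))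

theorem summable_stayProb {t : ℝ} (ht : 0 ≤ t) (α : SB B q) (M : ℤ) :
    Summable fun n : ℕ => (massRatio α M n - massRatio α M (n + 1)) * decay a t α (M + n) := by
  refine (hasSum_massRatio hB α M).summable.of_nonneg_of_le (fun n => ?_) fun n => ?_
  · exact mul_nonneg (sub_nonneg.2 (massRatio_succ_le hB α M n)) (Real.exp_nonneg _)
  · exact mul_le_of_le_one_right (sub_nonneg.2 (massRatio_succ_le hB α M n))
      (decay_le_one hB ha ha_top ht α _)

theorem stayProb_le_one {t : ℝ} (ht : 0 ≤ t) (α : SB B q) (M : ℤ) : stayProb a t α M ≤ 1 := by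
  rw [stayProb_eq hB, ← (hasSum_massRatio hB α M).tsum_eq]
  refine (summable_stayProb hB ha ha_top ht α M).tsum_le_tsum (fun n => ?_)
    (hasSum_massRatio hB α M).summable
  exact mul_le_of_le_one_right (sub_nonneg.2 (massRatio_succ_le hB α M n))
      (decay_le_one hB ha ha_top ht α _)

theorem stayProb_succ {t : ℝ} (ht : 0 ≤ t) (α : SB B q) (M : ℤ) :
    stayProb a t α M = (1 - (α.br (M + 2) : ℝ)⁻¹) * decay a t α M +
      (α.br (M + 2) : ℝ)⁻¹ * stayProb a t α (M + 1) := by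
  rw [stayProb_eq hB, (summable_stayProb hB ha ha_top ht α M).tsum_eq_zero_add, stayProb_eq hB,
    ← tsum_mul_left]
  congr 1
  · simp [massRatio]
  · refine tsum_congr fun n => ?_
    rw [massRatio_succ' α M n, massRatio_succ' α M (n + 1), Nat.cast_succ,
      show M + ((n : ℤ) + 1) = M + 1 + n by ring]
    ring

/-- The extra term `u(α, 1, M)` in the rate is exactly what makes this telescope in `massRatio α M n
* a (M + n)`: the average of the rates is `a M`. -/
theorem hasSum_rate (α : SB B q) (M : ℤ) :
    HasSum (fun n : ℕ => (massRatio α M n - massRatio α M (n + 1)) * rate a α (M + n)) (a M) := by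
  have h : ∀ n : ℕ, (massRatio α M n - massRatio α M (n + 1)) * rate a α (M + n) =
      massRatio α M n * a (M + n) - massRatio α M (n + 1) * a (M + (n + 1 : ℕ)) := by
    intro n
    have h2 := two_le_br hB α (M + n + 2)
    rw [rate_eq, massRatio_succ, Nat.cast_succ, ← add_assoc]
    have h3 : (α.br (M + n + 2) : ℝ) - 1 ≠ 0 := by linarith
    have h4 : (α.br (M + n + 2) : ℝ) ≠ 0 := by linarith
    field_simp
    ring
  simp only [h]
  have hz := hasSum_telescope_of_nonneg (f := fun n : ℕ => massRatio α M n * a (M + n))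
    (fun n => ?_) ?_
  · simpa [massRatio_zero] using hz
  · rw [← sub_nonneg, ← h n]
    exact mul_nonneg (sub_nonneg.2 (massRatio_succ_le hB α M n)) (rate_nonneg hB ha ha_top α _)
  · have ht : Tendsto (fun n : ℕ => a (M + n)) atTop (𝓝 0) :=
      ha_top.comp (tendsto_atTop_add_const_left _ _ tendsto_natCast_atTop_atTop)
    simpa using (massRatio_tendsto hB α M).mul ht

/-- Jensen's inequality for `exp`, the mean of the rates being `a M`. It is proved by summing the
tangent-line bound at the mean. -/
theorem exp_le_stayProb {t : ℝ} (ht : 0 ≤ t) (α : SB B q) (M : ℤ) :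
    Real.exp (-(a M * t)) ≤ stayProb a t α M := by
  have h1 : HasSum (fun n : ℕ => Real.exp (-(a M * t)) * ((1 + a M * t) *
      (massRatio α M n - massRatio α M (n + 1)) -
        t * ((massRatio α M n - massRatio α M (n + 1)) * rate a α (M + n))))
      (Real.exp (-(a M * t)) * ((1 + a M * t) * 1 - t * a M)) :=
    (((hasSum_massRatio hB α M).mul_left _).sub
      ((hasSum_rate hB ha ha_top α M).mul_left _)).mul_left _
  rw [show (1 + a M * t) * 1 - t * a M = 1 by ring, mul_one] at h1
  rw [stayProb_eq hB, ← h1.tsum_eq]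
  refine h1.summable.tsum_le_tsum (fun n => ?_) (summable_stayProb hB ha ha_top ht α M)
  have hw := sub_nonneg.2 (massRatio_succ_le hB α M n)
  have hexp : Real.exp (-(a M * t)) * (1 + a M * t - t * rate a α (M + n)) ≤
      decay a t α (M + n) := by
    rw [decay_eq, show -(rate a α (M + n) * t) =
      -(a M * t) + (a M * t - t * rate a α (M + n)) by ring, Real.exp_add]
    refine mul_le_mul_of_nonneg_left ?_ (Real.exp_nonneg _)
    linarith [Real.add_one_le_exp (a M * t - t * rate a α (M + n))]
  calc _ = (massRatio α M n - massRatio α M (n + 1)) *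
        (Real.exp (-(a M * t)) * (1 + a M * t - t * rate a α (M + n))) := by ring
    _ ≤ _ := mul_le_mul_of_nonneg_left hexp hw

theorem stayProb_nonneg {t : ℝ} (ht : 0 ≤ t) (α : SB B q) (M : ℤ) : 0 ≤ stayProb a t α M :=
  (Real.exp_nonneg _).trans (exp_le_stayProb hB ha ha_top ht α M)

/-- Makes the bracket in `moveProb` nonnegative, through `a (M + 1) ≤ a M ≤ rate a α M` and Jensen.
-/
theorem decay_le_stayProb_succ {t : ℝ} (ht : 0 ≤ t) (α : SB B q) (M : ℤ) :
    decay a t α M ≤ stayProb a t α (M + 1) := by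
  refine le_trans ?_ (exp_le_stayProb hB ha ha_top ht α (M + 1))
  rw [decay_eq]
  refine Real.exp_le_exp.2 (neg_le_neg (mul_le_mul_of_nonneg_right ?_ ht))
  exact (ha M).trans (le_rate hB ha α M)

end Rates

end SB

end Multibranch

/-! ### Transition probabilities and the kernel -/

namespace Multibranch

variable {B : FinSeq → ℕ} {q : ℝ}

namespace SB

theorem bProd_congr {α β : SB B q} {k : ℕ} {M : ℤ} (hk : 1 ≤ k)
    (h : ∀ n, M < n → β.br n = α.br n) : bProd β k M = bProd α k M := by
  unfold bProd
  rw [h _ (by omega)]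
  congr 1
  refine Finset.prod_congr rfl fun j hj => ?_
  rw [h]
  have := (Finset.mem_Icc.1 hj).1
  omega

theorem bProd_succ (α : SB B q) {k : ℕ} (hk : 1 ≤ k) (M : ℤ) :
    bProd α (k + 1) M = α.br (M + 2) * bProd α k (M + 1) := by
  unfold bProd
  have h1 : M + ((k + 1 : ℕ) : ℤ) + 1 = M + 1 + k + 1 := by push_cast; ring
  have h2 : ∏ j ∈ Finset.Icc 2 (k + 1), (α.br (M + j) : ℝ) =
      α.br (M + 2) * ∏ j ∈ Finset.Icc 2 k, (α.br (M + 1 + j) : ℝ) := by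
    have e : Finset.Icc 2 (k + 1) = insert 2 ((Finset.Icc 2 k).image (· + 1)) := by
      ext j
      simp only [Finset.mem_Icc, Finset.mem_insert, Finset.mem_image]
      constructor
      · intro h
        by_cases hj : j = 2
        · exact Or.inl hj
        · exact Or.inr ⟨j - 1, by omega, by omega⟩
      · rintro (rfl | ⟨i, hi, rfl⟩) <;> omega
    rw [e, Finset.prod_insert (by simp), Finset.prod_image (by simp)]
    congr 1
    refine Finset.prod_congr rfl fun j _ => ?_
    congr 2
    push_cast
    ring
  rw [h1, h2]
  ring

theorem bProd_one (α : SB B q) (M : ℤ) : bProd α 1 M = (α.br (M + 2) : ℝ) - 1 := by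
  simp [bProd, add_assoc, one_add_one_eq_two]

theorem bProd_nonneg (hB : ∀ s, 2 ≤ B s) (α : SB B q) (k : ℕ) (M : ℤ) : 0 ≤ bProd α k M := by
  refine mul_nonneg ?_ (Finset.prod_nonneg fun _ _ => (br_pos hB _ _).le)
  linarith [two_le_br hB α (M + k + 1)]

theorem decay_congr (a : ℤ → ℝ) (t : ℝ) {α β : SB B q} {M : ℤ}
    (h : β.br (M + 2) = α.br (M + 2)) : decay a t β M = decay a t α M := by
  rw [decay_eq, decay_eq, rate_eq, rate_eq, h]

theorem stayProb_congr (a : ℤ → ℝ) (t : ℝ) {α β : SB B q} {M : ℤ}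
    (h : ∀ n, M + 1 < n → β.br n = α.br n) : stayProb a t β M = stayProb a t α M := by
  unfold stayProb
  refine tsum_congr fun n => ?_
  rw [h _ (by omega), decay_congr a t (h _ (by omega))]
  congr 3
  exact Finset.prod_congr rfl fun j _ => by rw [h _ (by omega)]

variable [hq : Fact (1 < q)]

/-- The ultrametric property: all points of a ball are equally far from a point outside it. -/
theorem firstDiff_congr {α β β' : SB B q} {M : ℤ} (hβ : β ∉ ball α M) (h : β' ∈ ball β M) :
    firstDiff α β' = firstDiff α β := by
  have hne : α ≠ β := fun h => hβ (h ▸ mem_ball_self _ _)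
  have hβ' : β' ∉ ball α M := fun hm =>
    hβ (mem_ball_comm.1 ((mem_ball_congr h).1 (mem_ball_comm.1 hm)))
  have hne' : α ≠ β' := fun h => hβ' (h ▸ mem_ball_self _ _)
  have key : ∀ {α γ : SB B q}, γ ∉ ball α M → firstDiff α γ < -M := by
    intro α γ hγ
    by_contra hcon
    refine hγ (mem_ball_iff.2 fun i hi => ?_)
    by_contra hd
    have := firstDiff_le (Ne.symm hd)
    omega
  apply le_antisymm
  · apply firstDiff_le
    rw [mem_ball_iff.1 h _ (key hβ)]
    exact firstDiff_spec hne
  · apply firstDiff_le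
    rw [← mem_ball_iff.1 h _ (key hβ')]
    exact firstDiff_spec hne'

theorem firstDiff_add_one_le {α β : SB B q} {M : ℤ} (h : β ∉ ball α M) :
    M + 1 ≤ -firstDiff α β := by
  by_contra hcon
  refine h (mem_ball_iff.2 fun i hi => ?_)
  by_contra hd
  have := firstDiff_le (Ne.symm hd)
  omega

theorem mem_ball_iff_firstDiff {α β : SB B q} (h : α ≠ β) {M : ℤ} :
    β ∈ ball α M ↔ -firstDiff α β ≤ M := by
  constructor
  · intro hm
    by_contra hcon
    exact firstDiff_spec h (mem_ball_iff.1 hm _ (by omega)).symm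
  · intro hle
    by_contra hm
    have := firstDiff_add_one_le hm
    omega

theorem transProb_congr_right (a : ℤ → ℝ) (t : ℝ) {η β β' : SB B q} {M : ℤ}
    (h : β' ∈ ball β M) : transProb a t η β' M = transProb a t η β M := by
  have hiff : β' ∈ ball η M ↔ β ∈ ball η M := by
    rw [mem_ball_comm, mem_ball_congr h, mem_ball_comm]
  unfold transProb
  by_cases hm : β ∈ ball η M
  · rw [if_pos hm, if_pos (hiff.2 hm)]
  · rw [if_neg hm, if_neg (hiff.not.2 hm), firstDiff_congr hm h]
    have := firstDiff_add_one_le hm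
    unfold moveProb
    rw [bProd_congr (by omega) fun n hn => br_congr h hn]

theorem transProb_congr_left (a : ℤ → ℝ) (t : ℝ) {η η' β : SB B q} {M : ℤ}
    (h : η' ∈ ball η M) : transProb a t η' β M = transProb a t η β M := by
  have hiff : β ∈ ball η' M ↔ β ∈ ball η M := mem_ball_congr h
  have hcomm : ∀ α γ : SB B q, firstDiff α γ = firstDiff γ α := fun α γ => by
    simp only [firstDiff, ne_comm]
  unfold transProb
  by_cases hm : β ∈ ball η M
  · rw [if_pos hm, if_pos (hiff.2 hm)]
    exact stayProb_congr a t fun n hn => br_congr h (by omega)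
  · have hm' : η ∉ ball β M := fun hc => hm (mem_ball_comm.1 hc)
    rw [if_neg hm, if_neg (hiff.not.2 hm), hcomm η' β, firstDiff_congr hm' h, hcomm β η]
    have := firstDiff_add_one_le hm
    unfold moveProb
    rw [br_congr h (by omega), stayProb_congr a t fun n hn => br_congr h (by omega),
      decay_congr a t (br_congr h (by omega))]

/-- The Haar-like function `1_{K(β, q^M)} - μ(K(β, q^M)) / μ(K(β, q^(M+1))) 1_{K(β, q^(M+1))}`. -/
noncomputable def haarFun (β : SB B q) (M : ℤ) (η : SB B q) : ℝ :=
  (ball β M).indicator (fun _ => (1 : ℝ)) η -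
    (β.br (M + 2) : ℝ)⁻¹ * (ball β (M + 1)).indicator (fun _ => (1 : ℝ)) η

section Rates

variable (hB : ∀ s, 2 ≤ B s) {a : ℤ → ℝ} (ha : ∀ N, a (N + 1) ≤ a N)
  (ha_top : Tendsto a atTop (𝓝 0)) {t : ℝ} (ht : 0 ≤ t)
include hB ha ha_top ht

theorem transProb_nonneg (η β : SB B q) (M : ℤ) : 0 ≤ transProb a t η β M := by
  unfold transProb
  split_ifs with h
  · exact stayProb_nonneg hB ha ha_top ht _ _
  · have := firstDiff_add_one_le h
    generalize hk : (-firstDiff η β - M).toNat = k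
    obtain ⟨k, rfl⟩ : ∃ j, k = j + 1 := ⟨k - 1, by omega⟩
    unfold moveProb
    have h1 := two_le_br hB η (M + (k + 1 : ℕ) + 1)
    have h2 := decay_le_stayProb_succ hB ha ha_top ht η (M + (k + 1 : ℕ) - 1)
    rw [sub_add_cancel] at h2
    have h3 := bProd_nonneg hB β (k + 1) M
    refine mul_nonneg (mul_nonneg (mul_nonneg (inv_nonneg.2 h3) (inv_nonneg.2 ?_)) ?_) ?_ <;>
      linarith

/-- The central identity. Its cases are `η` in the ball (the recursion for `stayProb`), `η` in a
sibling ball, and `η` outside the parent, where the Haar function vanishes and `bProd` gains just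
the factor `b_β(M+2)`. -/
theorem transProb_succ (η β : SB B q) (M : ℤ) :
    transProb a t η β M = (β.br (M + 2) : ℝ)⁻¹ * transProb a t η β (M + 1) +
      decay a t β M * haarFun β M η := by
  have hb := two_le_br hB β (M + 2)
  unfold transProb haarFun
  by_cases h : β ∈ ball η M
  · have h' := ball_mono η (show M ≤ M + 1 by omega) h
    rw [if_pos h, if_pos h', Set.indicator_of_mem (mem_ball_comm.1 h),
      Set.indicator_of_mem (mem_ball_comm.1 h'), stayProb_succ hB ha ha_top ht,
      decay_congr a t (br_congr h (by omega)), br_congr h (by omega)]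
    ring
  · rw [if_neg h, Set.indicator_of_notMem fun hc => h (mem_ball_comm.1 hc)]
    have hne : η ≠ β := fun hc => h (hc ▸ mem_ball_self _ _)
    have hd := firstDiff_add_one_le h
    by_cases h' : β ∈ ball η (M + 1)
    · rw [if_pos h', Set.indicator_of_mem (mem_ball_comm.1 h')]
      -- Sibling case: `bProd` is `b_β(M+2) - 1` and cancels the last factor of `moveProb`.
      have hk : (-firstDiff η β - M).toNat = 1 := by
        have := (mem_ball_iff_firstDiff hne).1 h'
        omega
      rw [hk, moveProb, bProd_one, Nat.cast_one, add_sub_cancel_right, add_assoc M 1 1,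
        one_add_one_eq_two, ← br_congr h' (by omega),
        decay_congr a t (br_congr h' (show M + 1 < M + 2 by omega))]
      have h1 : (β.br (M + 2) : ℝ) - 1 ≠ 0 := by linarith
      have h2 : (β.br (M + 2) : ℝ) ≠ 0 := by linarith
      field_simp
      ring
    · rw [if_neg h', Set.indicator_of_notMem fun hc => h' (mem_ball_comm.1 hc)]
      have hd' := firstDiff_add_one_le h'
      obtain ⟨k, hk⟩ : ∃ k, (-firstDiff η β - (M + 1)).toNat = k := ⟨_, rfl⟩
      have hk' : (-firstDiff η β - M).toNat = k + 1 := by omega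
      rw [hk, hk', moveProb, moveProb, bProd_succ β (by omega) M, mul_inv]
      have : M + ((k + 1 : ℕ) : ℤ) = M + 1 + k := by push_cast; ring
      rw [this]
      ring

/-- On summing `transProb_succ` over the children, their Haar functions cancel and the uniform
shares add up to the parent's value. -/
theorem isBallContent_transProb (η : SB B q) :
    IsBallContent hB fun β M => ENNReal.ofReal (transProb a t η β M) := by
  refine isBallContent_ofReal (fun β M => transProb_nonneg hB ha ha_top ht η β M)
    (transProb_congr_right a t) fun β M => ?_
  classical
  have hb := (br_pos hB β (M + 2)).ne'
  have h1 : ∀ v, transProb a t η (child hB β M v) M =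
      (β.br (M + 2) : ℝ)⁻¹ * transProb a t η β (M + 1) + decay a t β M *
        ((if η ∈ ball (child hB β M v) M then 1 else 0) - (β.br (M + 2) : ℝ)⁻¹ *
          (if η ∈ ball β (M + 1) then 1 else 0)) := by
    intro v
    have hm := child_mem hB β M v
    have hbr := br_congr hm (show M + 1 < M + 2 by omega)
    rw [transProb_succ hB ha ha_top ht, transProb_congr_right a t hm, haarFun,
      decay_congr a t hbr, hbr, ball_congr hm, Set.indicator_apply, Set.indicator_apply]
  simp only [h1, Finset.sum_add_distrib, ← Finset.mul_sum, Finset.sum_sub_distrib, sum_child_mem]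
  simp only [Finset.sum_const, Finset.card_univ, Fintype.card_fin, nsmul_eq_mul]
  field_simp
  ring

theorem kernelP_ball (η β : SB B q) (M : ℤ) :
    kernelP a t η (ball β M) = ENNReal.ofReal (transProb a t η β M) :=
  (isBallContent_transProb hB ha ha_top ht η).ballMeasure_ball β M

theorem kernelP_univ_le (η : SB B q) : kernelP a t η Set.univ ≤ 1 := by
  rw [← iUnion_ball η, (monotone_ball η).measure_iUnion]
  refine iSup_le fun L => ?_
  rw [kernelP_ball hB ha ha_top ht, transProb, if_pos (mem_ball_self _ _)]
  exact ENNReal.ofReal_le_one.2 (stayProb_le_one hB ha ha_top ht η L)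

end Rates

omit hq in
theorem countable_setOf_eventually_zero :
    {α : SB B q | ∃ N : ℤ, ∀ i, N ≤ i → α.seq i = 0}.Countable := by
  classical
  have hfin : ∀ α : {α : SB B q | ∃ N : ℤ, ∀ i, N ≤ i → α.seq i = 0},
      (Function.support α.1.seq).Finite := by
    rintro ⟨α, N, hN⟩
    obtain ⟨N', hN'⟩ := α.eventually_zero
    refine (Set.finite_Ioo N' N).subset fun i hi => ⟨?_, ?_⟩ <;> by_contra hcon <;> push Not at hcon
    · exact hi (hN' i hcon)
    · exact hi (hN i hcon)
  refine Set.countable_coe_iff.1 (Function.Injective.countable (β := ℤ →₀ ℕ)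
    (f := fun α => Finsupp.ofSupportFinite α.1.seq (hfin α)) fun α β h => ?_)
  apply Subtype.ext
  apply SB.ext
  exact congrArg (fun f : ℤ →₀ ℕ => (f : ℤ → ℕ)) h

/-- The collection of all balls. -/
def balls (B : FinSeq → ℕ) (q : ℝ) [Fact (1 < q)] : Set (Set (SB B q)) :=
  {s | ∃ (α : SB B q) (N : ℤ), s = ball α N}

theorem exists_ball_subset (α : SB B q) {u : Set (SB B q)} (hu : IsOpen u) (hα : α ∈ u) :
    ∃ N : ℤ, ball α N ⊆ u := by
  obtain ⟨ε, hε, h⟩ := Metric.isOpen_iff.1 hu α hα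
  have hq1 : 1 < q := hq.out
  have hq0 : 0 < q := zero_lt_one.trans hq1
  obtain ⟨n, hn⟩ := exists_pow_lt_of_lt_one hε (inv_lt_one_of_one_lt₀ hq1)
  refine ⟨-n, (Metric.closedBall_subset_ball ?_).trans h⟩
  rwa [zpow_neg, zpow_natCast, ← inv_pow]

theorem exists_finsupp_mem_ball (hB : ∀ s, 2 ≤ B s) (α : SB B q) (N : ℤ) :
    ∃ β ∈ ball α N, ∃ N' : ℤ, ∀ i, N' ≤ i → β.seq i = 0 := by
  obtain ⟨M, rfl⟩ : ∃ M, N = M + 1 := ⟨N - 1, by ring⟩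
  refine ⟨child hB α M ⟨_, seq_lt_of_mem (mem_ball_self α _)⟩, child_mem hB α M _, -M,
    fun i hi => ?_⟩
  simp only [child]
  rw [if_neg (by omega), if_neg (by omega)]

theorem separableSpace (hB : ∀ s, 2 ≤ B s) : TopologicalSpace.SeparableSpace (SB B q) := by
  refine ⟨_, countable_setOf_eventually_zero, dense_iff_inter_open.2 fun u hu ⟨α, hα⟩ => ?_⟩
  obtain ⟨N, hN⟩ := exists_ball_subset α hu hα
  obtain ⟨β, hβ, h⟩ := exists_finsupp_mem_ball hB α N
  exact ⟨β, hN hβ, h⟩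

theorem borel_eq_generateFrom_balls (hB : ∀ s, 2 ≤ B s) :
    (inferInstance : MeasurableSpace (SB B q)) = MeasurableSpace.generateFrom (balls B q) := by
  have := separableSpace (q := q) hB
  have := UniformSpace.secondCountable_of_separable (SB B q)
  have hbasis : TopologicalSpace.IsTopologicalBasis (balls B q) := by
    refine TopologicalSpace.isTopologicalBasis_of_isOpen_of_nhds ?_ fun α u hα hu => ?_
    · rintro _ ⟨α, N, rfl⟩
      exact isOpen_ball α N
    · obtain ⟨N, hN⟩ := exists_ball_subset α hu hα
      exact ⟨_, ⟨α, N, rfl⟩, mem_ball_self α N, hN⟩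
  exact hbasis.borel_eq_generateFrom

theorem isPiSystem_balls : IsPiSystem (balls B q) := by
  rintro _ ⟨α, M, rfl⟩ _ ⟨β, N, rfl⟩ ⟨γ, hα, hβ⟩
  rw [← ball_congr hα, ← ball_congr hβ]
  rcases le_total M N with h | h
  · exact ⟨γ, M, Set.inter_eq_left.2 (ball_mono γ h)⟩
  · exact ⟨γ, N, Set.inter_eq_right.2 (ball_mono γ h)⟩

end SB

end Multibranch

/-! ### `L²` contractions from sub-Markov kernels with an excessive measure -/

namespace Multibranch

section KernelOperator

open ProbabilityTheory

variable {X : Type*} [MeasurableSpace X] {μ : Measure X} {κ : Kernel X X}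

theorem eLpNorm_two_sq {ν : Measure X} (f : X → ℝ) :
    eLpNorm f 2 ν ^ (2 : ℝ) = ∫⁻ x, ‖f x‖ₑ ^ (2 : ℝ) ∂ν := by
  have := eLpNorm_nnreal_pow_eq_lintegral (μ := ν) (f := f) (p := 2) two_ne_zero
  simpa using this

theorem eLpNorm_one_le_of_measure_univ_le {ν : Measure X} (hν : ν Set.univ ≤ 1) {f : X → ℝ}
    (hf : AEStronglyMeasurable f ν) : eLpNorm f 1 ν ≤ eLpNorm f 2 ν := by
  refine (eLpNorm_le_eLpNorm_mul_rpow_measure_univ one_le_two hf).trans ?_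
  refine mul_le_of_le_one_right' (ENNReal.rpow_le_one hν ?_)
  norm_num

theorem lintegral_lintegral_le (hle : μ.bind κ ≤ μ) {g : X → ℝ≥0∞} (hg : Measurable g) :
    ∫⁻ x, ∫⁻ y, g y ∂κ x ∂μ ≤ ∫⁻ x, g x ∂μ := by
  rw [← Measure.lintegral_bind κ.measurable.aemeasurable hg.aemeasurable]
  exact lintegral_mono' hle le_rfl

/-- Makes integration against the kernel independent of the representative of an `L²` class. -/
theorem ae_ae_of_bind_le (hle : μ.bind κ ≤ μ) {p : X → Prop} (hp : ∀ᵐ x ∂μ, p x) :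
    ∀ᵐ x ∂μ, ∀ᵐ y ∂κ x, p y :=
  Measure.ae_ae_of_ae_bind κ.measurable.aemeasurable
    ((Measure.absolutelyContinuous_of_le hle).ae_le hp)

theorem ae_integrable_kernel (hfin : ∀ x, κ x Set.univ ≤ 1) (hle : μ.bind κ ≤ μ) (f : Lp ℝ 2 μ) :
    ∀ᵐ x ∂μ, Integrable f (κ x) := by
  have hf := (Lp.stronglyMeasurable f)
  have hfin2 : ∫⁻ x, ∫⁻ y, ‖f y‖ₑ ^ (2 : ℝ) ∂κ x ∂μ ≠ ⊤ := by
    refine ne_top_of_le_ne_top ?_ (lintegral_lintegral_le hle (by fun_prop))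
    rw [← eLpNorm_two_sq]
    exact ENNReal.rpow_ne_top_of_nonneg zero_le_two (Lp.eLpNorm_ne_top f)
  have hmeas : Measurable fun x => ∫⁻ y, ‖f y‖ₑ ^ (2 : ℝ) ∂κ x :=
    Measurable.lintegral_kernel (by fun_prop)
  filter_upwards [ae_lt_top hmeas hfin2] with x hx
  have h2 : eLpNorm f 2 (κ x) < ⊤ := by
    rw [← eLpNorm_two_sq] at hx
    exact (ENNReal.rpow_lt_top_iff_of_pos two_pos).1 hx
  exact memLp_one_iff_integrable.1 ⟨hf.aestronglyMeasurable,
    (eLpNorm_one_le_of_measure_univ_le (hfin x) hf.aestronglyMeasurable).trans_lt h2⟩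

/-- Since `κ x` has mass at most 1, the square of the integral is at most the integral of the
square; integrating in `x` and using excessiveness finishes. -/
theorem eLpNorm_integral_kernel_le (hfin : ∀ x, κ x Set.univ ≤ 1) (hle : μ.bind κ ≤ μ)
    (f : Lp ℝ 2 μ) : eLpNorm (fun x => ∫ y, f y ∂κ x) 2 μ ≤ eLpNorm f 2 μ := by
  have hf := (Lp.stronglyMeasurable f)
  rw [← ENNReal.rpow_le_rpow_iff (z := 2) two_pos, eLpNorm_two_sq, eLpNorm_two_sq]
  refine le_trans (lintegral_mono fun x => ?_) (lintegral_lintegral_le hle (by fun_prop))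
  rw [← eLpNorm_two_sq]
  refine ENNReal.rpow_le_rpow ?_ zero_le_two
  refine (enorm_integral_le_lintegral_enorm _).trans ?_
  rw [← eLpNorm_one_eq_lintegral_enorm]
  exact eLpNorm_one_le_of_measure_univ_le (hfin x) hf.aestronglyMeasurable

theorem memLp_integral_kernel (hfin : ∀ x, κ x Set.univ ≤ 1) (hle : μ.bind κ ≤ μ)
    (f : Lp ℝ 2 μ) : MemLp (fun x => ∫ y, f y ∂κ x) 2 μ :=
  ⟨(Lp.stronglyMeasurable f).integral_kernel.aestronglyMeasurable,
    (eLpNorm_integral_kernel_le hfin hle f).trans_lt (Lp.eLpNorm_lt_top f)⟩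

/-- The contraction on `L²(μ)` given by a sub-Markov kernel for which `μ` is excessive. -/
theorem exists_kernel_operator (hfin : ∀ x, κ x Set.univ ≤ 1) (hle : μ.bind κ ≤ μ) :
    ∃ T : Lp ℝ 2 μ →L[ℝ] Lp ℝ 2 μ, (∀ f, ‖T f‖ ≤ ‖f‖) ∧
      ∀ f : Lp ℝ 2 μ, ∀ᵐ x ∂μ, Integrable f (κ x) ∧ T f x = ∫ y, f y ∂κ x := by
  let T₀ : Lp ℝ 2 μ →ₗ[ℝ] Lp ℝ 2 μ :=
    { toFun := fun f => (memLp_integral_kernel hfin hle f).toLp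
      map_add' := fun f g => by
        rw [← MemLp.toLp_add, MemLp.toLp_eq_toLp_iff]
        filter_upwards [ae_integrable_kernel hfin hle f, ae_integrable_kernel hfin hle g,
          ae_ae_of_bind_le hle (Lp.coeFn_add f g)] with x hf hg hfg
        rw [integral_congr_ae hfg]
        exact integral_add hf hg
      map_smul' := fun c f => by
        rw [← MemLp.toLp_const_smul, MemLp.toLp_eq_toLp_iff]
        filter_upwards [ae_ae_of_bind_le hle (Lp.coeFn_smul c f)] with x hcf
        rw [integral_congr_ae hcf]
        exact integral_smul c _ }
  have hT₀ : ∀ f, ‖T₀ f‖ ≤ 1 * ‖f‖ := fun f => by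
    rw [one_mul]
    change ‖(memLp_integral_kernel hfin hle f).toLp‖ ≤ _
    rw [Lp.norm_toLp, Lp.norm_def]
    exact ENNReal.toReal_mono (Lp.eLpNorm_ne_top f) (eLpNorm_integral_kernel_le hfin hle f)
  refine ⟨T₀.mkContinuous 1 hT₀, fun f => by simpa using hT₀ f, fun f => ?_⟩
  filter_upwards [ae_integrable_kernel hfin hle f,
    (memLp_integral_kernel hfin hle f).coeFn_toLp] with x h1 h2
  exact ⟨h1, h2⟩

end KernelOperator

/-! ### The operators `T_t` and their Haar eigenfunctions -/

variable {B : FinSeq → ℕ} {q : ℝ} [hq : Fact (1 < q)]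

namespace SB

theorem measurable_transProb (a : ℤ → ℝ) (t : ℝ) (β : SB B q) (M : ℤ) :
    Measurable fun η => transProb a t η β M := by
  have : IsLocallyConstant fun η => transProb a t η β M :=
    (IsLocallyConstant.iff_eventually_eq _).2 fun η => by
      filter_upwards [(isOpen_ball η M).mem_nhds (mem_ball_self η M)] with η' h
      exact transProb_congr_left a t h
  exact this.continuous.measurable

theorem integral_haarFun (hB : ∀ s, 2 ≤ B s) (β : SB B q) {M L : ℤ} (h : M + 1 ≤ L) :
    IntegrableOn (haarFun β M) (ball β L) (mu B q) ∧
      ∫ η in ball β L, haarFun β M η ∂(mu B q) = 0 := by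
  have hint : ∀ N, IntegrableOn ((ball β N).indicator fun _ => (1 : ℝ)) (ball β L) (mu B q) :=
    fun N => by
      refine IntegrableOn.indicator ?_ (measurableSet_ball β N)
      exact integrableOn_const (mu_ball_ne_top hB β L)
  have hval : ∀ N, N ≤ L → ∫ η in ball β L, (ball β N).indicator (fun _ => (1 : ℝ)) η ∂(mu B q) =
      ballMass β N := fun N hN => by
    rw [setIntegral_indicator (measurableSet_ball β N),
      Set.inter_eq_right.2 (ball_mono β hN), setIntegral_const, mu_real_ball hB, smul_eq_mul,
      mul_one]
  refine ⟨(hint M).sub ((hint (M + 1)).const_mul _), ?_⟩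
  unfold haarFun
  rw [integral_sub (hint M) ((hint (M + 1)).const_mul _), integral_const_mul,
    hval _ h, hval _ (by omega), ballMass_succ hB,
    inv_mul_cancel_left₀ (br_pos hB _ _).ne', sub_self]

/-- The indicator function of `K(β, q^M)` as an element of `L²`. -/
noncomputable def ballLp (hB : ∀ s, 2 ≤ B s) (β : SB B q) (M : ℤ) : L2 B q :=
  indicatorConstLp 2 (measurableSet_ball β M) (mu_ball_ne_top hB β M) 1

theorem ballLp_coeFn (hB : ∀ s, 2 ≤ B s) (β : SB B q) (M : ℤ) :
    ballLp hB β M =ᵐ[mu B q] (ball β M).indicator fun _ => (1 : ℝ) :=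
  indicatorConstLp_coeFn

/-- The function `haarFun β M` as an element of `L²`. -/
noncomputable def haarLp (hB : ∀ s, 2 ≤ B s) (β : SB B q) (M : ℤ) : L2 B q :=
  ballLp hB β M - (β.br (M + 2) : ℝ)⁻¹ • ballLp hB β (M + 1)

section Rates

variable (hB : ∀ s, 2 ≤ B s) {a : ℤ → ℝ} (ha : ∀ N, a (N + 1) ≤ a N)
  (ha_top : Tendsto a atTop (𝓝 0)) {t : ℝ} (ht : 0 ≤ t)
include hB ha ha_top ht

/-- At radius `q^L` the integrand is constant on the ball. Each descent by `transProb_succ` divides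
it by the branching number and adds a Haar term of integral zero. -/
theorem setIntegral_transProb (β : SB B q) (L : ℤ) (n : ℕ) :
    IntegrableOn (fun η => transProb a t η β (L - n)) (ball β L) (mu B q) ∧
      ∫ η in ball β L, transProb a t η β (L - n) ∂(mu B q) =
        ballMass β (L - n) * stayProb a t β L := by
  induction n with
  | zero =>
    have hconst : Set.EqOn (fun η => transProb a t η β (L - (0 : ℕ)))
        (fun _ => stayProb a t β L) (ball β L) := fun η hη => by
      simp only [Nat.cast_zero, sub_zero]
      rw [transProb_congr_left a t hη, transProb, if_pos (mem_ball_self _ _)]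
    constructor
    · refine IntegrableOn.congr_fun ?_ hconst.symm (measurableSet_ball β L)
      exact integrableOn_const (mu_ball_ne_top hB β L)
    · rw [setIntegral_congr_fun (measurableSet_ball β L) hconst, setIntegral_const,
        mu_real_ball hB, smul_eq_mul, Nat.cast_zero, sub_zero]
  | succ n ih =>
    have hM : L - ((n + 1 : ℕ) : ℤ) + 1 = L - n := by push_cast; ring
    obtain ⟨h1, h2⟩ := integral_haarFun hB β (show L - ((n + 1 : ℕ) : ℤ) + 1 ≤ L by omega)
    have hrec : (fun η => transProb a t η β (L - ((n + 1 : ℕ) : ℤ))) = fun η =>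
        (β.br (L - ((n + 1 : ℕ) : ℤ) + 2) : ℝ)⁻¹ * transProb a t η β (L - n) +
          decay a t β (L - ((n + 1 : ℕ) : ℤ)) * haarFun β (L - ((n + 1 : ℕ) : ℤ)) η := by
      funext η
      rw [transProb_succ hB ha ha_top ht, hM]
    rw [hrec]
    refine ⟨(ih.1.const_mul _).add (h1.const_mul _), ?_⟩
    rw [integral_add (ih.1.const_mul _) (h1.const_mul _), integral_const_mul, integral_const_mul,
      h2, ih.2, ← hM, ballMass_succ hB, mul_zero, add_zero, mul_assoc,
      inv_mul_cancel_left₀ (br_pos hB _ _).ne']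

/-- Exhaust the space by balls around `β`; on each one the integral is the mass of the target ball
times a staying probability, which is at most 1. -/
theorem lintegral_kernelP_ball_le (β : SB B q) (M : ℤ) :
    ∫⁻ η, kernelP a t η (ball β M) ∂(mu B q) ≤ mu B q (ball β M) := by
  have hdir : Monotone fun L : ℕ => ball β (M + L) := fun L L' h =>
    ball_mono β (by have : (L : ℤ) ≤ L' := by exact_mod_cast h
                    omega)
  have huniv : ⋃ L : ℕ, ball β (M + L) = Set.univ := by
    refine Set.eq_univ_of_forall fun η => ?_
    obtain ⟨L, hL⟩ := exists_mem_ball β η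
    exact Set.mem_iUnion.2 ⟨(L - M).toNat, ball_mono β (by omega) hL⟩
  rw [← setLIntegral_univ, ← huniv, setLIntegral_iUnion_of_directed _ hdir.directed_le]
  refine iSup_le fun L => ?_
  simp only [kernelP_ball hB ha ha_top ht]
  obtain ⟨h1, h2⟩ := setIntegral_transProb hB ha ha_top ht β (M + L) L
  rw [add_sub_cancel_right] at h1 h2
  rw [← ofReal_integral_eq_lintegral_ofReal h1
    (Eventually.of_forall fun η => transProb_nonneg hB ha ha_top ht η β M), h2, mu_ball hB]
  exact ENNReal.ofReal_le_ofReal (mul_le_of_le_one_right (ballMass_pos hB β M).le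
    (stayProb_le_one hB ha ha_top ht β _))

theorem exists_kernel : ∃ κ : ProbabilityTheory.Kernel (SB B q) (SB B q),
    (∀ η, κ η = kernelP a t η) ∧ (∀ η, κ η Set.univ ≤ 1) ∧ (mu B q).bind κ ≤ mu B q := by
  have hfin : ∀ η : SB B q, IsFiniteMeasure (kernelP a t η) := fun η =>
    ⟨(kernelP_univ_le hB ha ha_top ht η).trans_lt ENNReal.one_lt_top⟩
  have hball : ∀ (β : SB B q) M, Measurable fun η => kernelP a t η (ball β M) := fun β M => by
    simp only [kernelP_ball hB ha ha_top ht]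
    exact (measurable_transProb a t β M).ennreal_ofReal
  have hmeas : Measurable fun η : SB B q => kernelP a t η := by
    refine Measurable.measure_of_isPiSystem (borel_eq_generateFrom_balls hB) isPiSystem_balls ?_ ?_
    · rintro _ ⟨β, M, rfl⟩
      exact hball β M
    · simp only [← iUnion_ball (zero hB), (monotone_ball (zero hB)).measure_iUnion]
      exact Measurable.iSup fun L => hball _ _
  refine ⟨⟨fun η => kernelP a t η, hmeas⟩, fun _ => rfl, kernelP_univ_le hB ha ha_top ht, ?_⟩
  refine le_ballMeasure fun β M => ?_
  rw [← mu_ball hB]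
  refine (Measure.bind_apply (measurableSet_ball β M) hmeas.aemeasurable).trans_le ?_
  exact lintegral_kernelP_ball_le hB ha ha_top ht β M

/-- The kernel prescribes the values almost everywhere, so the operator picked by choice agrees with
the contraction constructed from the kernel. -/
theorem semigroupT_spec :
    HasKernel a t (semigroupT B q a t) ∧ ∀ f, ‖semigroupT B q a t f‖ ≤ ‖f‖ := by
  obtain ⟨κ, hκ, hfin, hle⟩ := exists_kernel (q := q) hB ha ha_top ht
  obtain ⟨T, hT, hTk⟩ := exists_kernel_operator hfin hle
  have hex : ∃ T : L2 B q →L[ℝ] L2 B q, HasKernel a t T := ⟨T, fun f => by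
    filter_upwards [hTk f] with η h
    rwa [hκ] at h⟩
  have hspec : HasKernel a t (semigroupT B q a t) := by
    rw [semigroupT, dif_pos hex]
    exact hex.choose_spec
  refine ⟨hspec, fun f => ?_⟩
  have : semigroupT B q a t f = T f := by
    refine Lp.ext ?_
    filter_upwards [hspec f, hTk f] with η h1 h2
    rw [h1.2, h2.2, hκ]
  rw [this]
  exact hT f

theorem semigroupT_ballLp (β : SB B q) (M : ℤ) :
    semigroupT B q a t (ballLp hB β M) =ᵐ[mu B q] fun η => transProb a t η β M := by
  obtain ⟨κ, hκ, hfin, hle⟩ := exists_kernel (q := q) hB ha ha_top ht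
  filter_upwards [(semigroupT_spec hB ha ha_top ht).1 (ballLp hB β M),
    ae_ae_of_bind_le hle (ballLp_coeFn hB β M)] with η h1 h2
  rw [hκ] at h2
  rw [h1.2, integral_congr_ae h2, integral_indicator_const _ (measurableSet_ball β M),
    Measure.real, kernelP_ball hB ha ha_top ht,
    ENNReal.toReal_ofReal (transProb_nonneg hB ha ha_top ht η β M), smul_eq_mul, mul_one]

/-- This is `transProb_succ` with the uniform share moved to the left-hand side. -/
theorem semigroupT_haarLp (β : SB B q) (M : ℤ) :
    semigroupT B q a t (haarLp hB β M) = Real.exp (-(rate a β M * t)) • haarLp hB β M := by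
  rw [haarLp, map_sub, map_smul]
  refine Lp.ext ?_
  filter_upwards [Lp.coeFn_sub (semigroupT B q a t (ballLp hB β M))
      ((β.br (M + 2) : ℝ)⁻¹ • semigroupT B q a t (ballLp hB β (M + 1))),
    Lp.coeFn_smul (β.br (M + 2) : ℝ)⁻¹ (semigroupT B q a t (ballLp hB β (M + 1))),
    semigroupT_ballLp hB ha ha_top ht β M, semigroupT_ballLp hB ha ha_top ht β (M + 1),
    Lp.coeFn_smul (Real.exp (-(rate a β M * t)))
      (ballLp hB β M - (β.br (M + 2) : ℝ)⁻¹ • ballLp hB β (M + 1)),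
    Lp.coeFn_sub (ballLp hB β M) ((β.br (M + 2) : ℝ)⁻¹ • ballLp hB β (M + 1)),
    Lp.coeFn_smul (β.br (M + 2) : ℝ)⁻¹ (ballLp hB β (M + 1)),
    ballLp_coeFn hB β M, ballLp_coeFn hB β (M + 1)] with η h1 h2 h3 h4 h5 h6 h7 h8 h9
  rw [h1, Pi.sub_apply, h2, Pi.smul_apply, h3, h4, h5, Pi.smul_apply, h6, Pi.sub_apply, h7,
    Pi.smul_apply, h8, h9, transProb_succ hB ha ha_top ht η β M, decay_eq]
  simp only [smul_eq_mul, haarFun]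
  ring

end Rates

end SB

end Multibranch

/-! ### A core criterion for contraction families with a total set of eigenvectors -/

namespace Multibranch

section Generator

variable {E : Type*} [NormedAddCommGroup E] [NormedSpace ℝ E]

theorem mem_negGenerator_graph_iff {T : ℝ → E →L[ℝ] E} {x : E × E} :
    x ∈ (negGenerator T).graph ↔
      Tendsto (fun t : ℝ => t⁻¹ • (x.1 - T t x.1)) (𝓝[>] 0) (𝓝 x.2) := by
  rw [LinearPMap.mem_graph_iff]
  constructor
  · rintro ⟨f, hf, hx⟩
    rw [← hf, ← hx]
    exact negGenerator_spec T f
  · intro h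
    exact ⟨⟨x.1, x.2, h⟩, rfl, tendsto_nhds_unique (negGenerator_spec T _) h⟩

variable {T : ℝ → E →L[ℝ] E} {ι : Type*} {e : ι → E} {l : ι → ℝ}

theorem eigenvector_mem_graph (he : ∀ i, ∀ t > 0, T t (e i) = Real.exp (-(l i * t)) • e i) (i : ι) :
    (e i, l i • e i) ∈ (negGenerator T).graph := by
  rw [mem_negGenerator_graph_iff]
  have hd : HasDerivAt (fun t : ℝ => Real.exp (-(l i * t))) (-l i) 0 := by
    have := (((hasDerivAt_id (0 : ℝ)).const_mul (l i)).neg).exp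
    simpa using this
  have ht := (hd.tendsto_slope_zero_right.neg).smul_const (e i)
  rw [neg_neg] at ht
  refine ht.congr' ?_
  filter_upwards [self_mem_nhdsWithin] with t ht0
  rw [he i t ht0]
  simp only [zero_add, mul_zero, neg_zero, Real.exp_zero, smul_eq_mul]
  module

/-- The graph of the negative generator over the span of the eigenvectors `e i`. -/
def eigenGraph (e : ι → E) (l : ι → ℝ) : Submodule ℝ (E × E) :=
  Submodule.span ℝ (Set.range fun i => (e i, l i • e i))

theorem eigenGraph_le (he : ∀ i, ∀ t > 0, T t (e i) = Real.exp (-(l i * t)) • e i) :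
    eigenGraph e l ≤ (negGenerator T).graph :=
  Submodule.span_le.2 (by rintro _ ⟨i, rfl⟩; exact eigenvector_mem_graph he i)

/-- On finite combinations of eigenvectors the orbit `T s x.1` has derivative `-T s x.2`, of norm at
most `‖x.2‖`; the mean value inequality applies. -/
theorem norm_sub_le_of_mem_eigenGraph (hT : ∀ t > 0, ∀ f, ‖T t f‖ ≤ ‖f‖)
    (he : ∀ i, ∀ t > 0, T t (e i) = Real.exp (-(l i * t)) • e i) {x : E × E}
    (hx : x ∈ eigenGraph e l) {t : ℝ} (ht : 0 < t) : ‖x.1 - T t x.1‖ ≤ ‖x.2‖ * t := by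
  obtain ⟨c, rfl⟩ := (Finsupp.mem_span_range_iff_exists_finsupp).1 hx
  -- An explicit smooth orbit, with `u 0 = x.1`; nothing is assumed about `T 0`.
  set u : ℝ → E := fun s => c.sum fun i r => (r * Real.exp (-(l i * s))) • e i with hu
  set x : E × E := c.sum fun i r => r • (e i, l i • e i) with hxdef
  have hx1 : x.1 = c.sum fun i r => r • e i := by
    simp [hxdef, Finsupp.sum, Prod.fst_sum]
  have hx2 : x.2 = c.sum fun i r => r • l i • e i := by
    simp [hxdef, Finsupp.sum, Prod.snd_sum]
  have hu0 : u 0 = x.1 := by simp [hu, hx1]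
  have hus : ∀ s > 0, u s = T s x.1 := fun s hs => by
    simp only [hx1, hu, Finsupp.sum, map_sum]
    refine Finset.sum_congr rfl fun i _ => ?_
    rw [map_smul, he i s hs, smul_smul]
  have hu' : ∀ s, HasDerivAt u (-(c.sum fun i r => (r * Real.exp (-(l i * s))) • l i • e i)) s := by
    intro s
    simp only [hu, Finsupp.sum, ← Finset.sum_neg_distrib]
    refine HasDerivAt.fun_sum fun i _ => ?_
    have h1 : HasDerivAt (fun s : ℝ => Real.exp (-(l i * s))) (Real.exp (-(l i * s)) * -(l i)) s := by
      have := (((hasDerivAt_id s).const_mul (l i)).neg).exp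
      simpa using this
    convert (h1.const_mul (c i)).smul_const (e i) using 1
    rw [smul_smul, ← neg_smul]
    congr 1
    ring
  have hbound : ∀ s, 0 ≤ s →
      ‖-(c.sum fun i r => (r * Real.exp (-(l i * s))) • l i • e i)‖ ≤ ‖x.2‖ := by
    intro s hs
    rw [norm_neg]
    rcases hs.eq_or_lt with rfl | hs
    · simp [hx2]
    · refine le_trans (le_of_eq ?_) (hT s hs x.2)
      rw [hx2, Finsupp.sum, Finsupp.sum, map_sum]
      congr 1
      refine Finset.sum_congr rfl fun i _ => ?_
      rw [map_smul, map_smul, he i s hs, smul_smul, smul_smul, smul_smul]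
      congr 1
      ring
  have := norm_image_sub_le_of_norm_deriv_le_segment' (f := u) (a := 0) (b := t) (C := ‖x.2‖)
    (fun s _ => (hu' s).hasDerivWithinAt) (fun s hs => hbound s hs.1) t ⟨ht.le, le_rfl⟩
  rwa [sub_zero, hu0, hus t ht, norm_sub_rev] at this

theorem norm_sub_le_of_mem_closure_eigenGraph (hT : ∀ t > 0, ∀ f, ‖T t f‖ ≤ ‖f‖)
    (he : ∀ i, ∀ t > 0, T t (e i) = Real.exp (-(l i * t)) • e i) {x : E × E}
    (hx : x ∈ (eigenGraph e l).topologicalClosure) {t : ℝ} (ht : 0 < t) :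
    ‖x.1 - T t x.1‖ ≤ ‖x.2‖ * t := by
  have hcl : IsClosed {x : E × E | ‖x.1 - T t x.1‖ ≤ ‖x.2‖ * t} :=
    isClosed_le (by fun_prop) (by fun_prop)
  exact closure_minimal (fun y hy => norm_sub_le_of_mem_eigenGraph hT he hy ht) hcl hx

/-- The difference quotients are bounded by the second component uniformly in `t`, so their
convergence passes to limits by an `ε/3` argument. -/
theorem closure_eigenGraph_le (hT : ∀ t > 0, ∀ f, ‖T t f‖ ≤ ‖f‖)
    (he : ∀ i, ∀ t > 0, T t (e i) = Real.exp (-(l i * t)) • e i) :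
    (eigenGraph e l).topologicalClosure ≤ (negGenerator T).graph := by
  intro x hx
  rw [mem_negGenerator_graph_iff, Metric.tendsto_nhds]
  intro ε hε
  obtain ⟨y, hy, hxy⟩ := Metric.mem_closure_iff.1 hx (ε / 3) (by positivity)
  have hy2 : ‖x.2 - y.2‖ < ε / 3 := by
    rw [← dist_eq_norm]
    exact (le_max_right _ _).trans_lt hxy
  have h1 := (Metric.tendsto_nhds.1 (mem_negGenerator_graph_iff.1 (eigenGraph_le he hy)))
    (ε / 3) (by positivity)
  filter_upwards [h1, self_mem_nhdsWithin] with t h2 ht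
  have ht : 0 < t := ht
  have h3 := norm_sub_le_of_mem_closure_eigenGraph hT he
    (sub_mem hx (Submodule.le_topologicalClosure _ hy)) ht
  have h4 : ‖t⁻¹ • ((x - y).1 - T t (x - y).1)‖ ≤ ‖x.2 - y.2‖ := by
    rw [norm_smul, norm_inv, Real.norm_of_nonneg ht.le, inv_mul_le_iff₀ ht, mul_comm]
    exact h3
  rw [dist_eq_norm] at h2 ⊢
  have h5 : t⁻¹ • (x.1 - T t x.1) - x.2 = t⁻¹ • ((x - y).1 - T t (x - y).1) +
      (t⁻¹ • (y.1 - T t y.1) - y.2) + (y.2 - x.2) := by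
    rw [Prod.fst_sub, map_sub]
    module
  rw [h5]
  refine (norm_add₃_le).trans_lt ?_
  rw [norm_sub_rev y.2]
  linarith

/-- Accretivity of `H`, the limit of `(1 + t⁻¹)‖f‖ ≤ ‖f + t⁻¹(f - T_t f)‖ + t⁻¹‖f‖`. It makes `1 +
H` injective. -/
theorem norm_le_of_mem_negGenerator_graph (hT : ∀ t > 0, ∀ f, ‖T t f‖ ≤ ‖f‖) {x : E × E}
    (hx : x ∈ (negGenerator T).graph) : ‖x.1‖ ≤ ‖x.1 + x.2‖ := by
  have h := ((mem_negGenerator_graph_iff.1 hx).const_add x.1).norm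
  refine ge_of_tendsto h ?_
  filter_upwards [self_mem_nhdsWithin] with t ht
  have ht : 0 < t := ht
  have h1 : (1 + t⁻¹) • x.1 = x.1 + t⁻¹ • (x.1 - T t x.1) + t⁻¹ • T t x.1 := by module
  have h2 := norm_add_le (x.1 + t⁻¹ • (x.1 - T t x.1)) (t⁻¹ • T t x.1)
  have hi : 0 < t⁻¹ := inv_pos.2 ht
  rw [← h1, norm_smul, norm_smul, Real.norm_of_nonneg hi.le,
    Real.norm_of_nonneg (by positivity)] at h2
  have h3 := mul_le_mul_of_nonneg_left (hT t ht x.1) hi.le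
  linarith

/-- `1 + H` is already onto when restricted to the closed graph `G`, and it is injective on the full
graph, so the full graph cannot be larger. -/
theorem graph_eq_closure_eigenGraph [CompleteSpace E] (hT : ∀ t > 0, ∀ f, ‖T t f‖ ≤ ‖f‖)
    (he : ∀ i, ∀ t > 0, T t (e i) = Real.exp (-(l i * t)) • e i) (hl : ∀ i, 0 ≤ l i)
    (hdense : (Submodule.span ℝ (Set.range e)).topologicalClosure = ⊤) :
    (negGenerator T).graph = (eigenGraph e l).topologicalClosure := by
  refine le_antisymm (fun x hx => ?_) (closure_eigenGraph_le hT he)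
  set G := (eigenGraph e l).topologicalClosure with hG
  have hGle : G ≤ (negGenerator T).graph := closure_eigenGraph_le hT he
  have : CompleteSpace G := (Submodule.isClosed_topologicalClosure _).completeSpace_coe
  let S : G →L[ℝ] E := (ContinuousLinearMap.fst ℝ E E + ContinuousLinearMap.snd ℝ E E).comp
    G.subtypeL
  have hS : ∀ y : G, S y = y.1.1 + y.1.2 := fun _ => rfl
  -- Accretivity bounds the first component by `‖S y‖`, hence the second by `2‖S y‖`.
  have hanti : AntilipschitzWith 2 S := by
    refine AddMonoidHomClass.antilipschitz_of_bound S fun y => ?_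
    have h1 := norm_le_of_mem_negGenerator_graph hT (hGle y.2)
    have h2 : ‖y.1.2‖ ≤ ‖y.1.1 + y.1.2‖ + ‖y.1.1‖ := by
      simpa using norm_sub_le (y.1.1 + y.1.2) y.1.1
    rw [hS]
    change ‖y.1‖ ≤ _
    rw [Prod.norm_def]
    have h0 := norm_nonneg (y.1.1 + y.1.2)
    exact max_le (by push_cast; linarith) (by push_cast; linarith)
  have hclosed : IsClosed (Set.range S) := hanti.isClosed_range S.uniformContinuous
  have hrange : LinearMap.range (S : G →ₗ[ℝ] E) = ⊤ := by
    rw [eq_top_iff, ← hdense]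
    refine Submodule.topologicalClosure_minimal _ (Submodule.span_le.2 ?_) hclosed
    rintro _ ⟨i, rfl⟩
    have hi : (e i, l i • e i) ∈ G :=
      Submodule.le_topologicalClosure _ (Submodule.subset_span ⟨i, rfl⟩)
    have h0 : (1 + l i) ≠ 0 := by linarith [hl i]
    -- `S` scales `e i` by `1 + l i`, which is nonzero because `l i ≥ 0`.
    refine ⟨(1 + l i)⁻¹ • ⟨_, hi⟩, ?_⟩
    rw [map_smul]
    change (1 + l i)⁻¹ • (e i + l i • e i) = e i
    rw [show e i + l i • e i = (1 + l i) • e i by module, inv_smul_smul₀ h0]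
  obtain ⟨y, hy⟩ := LinearMap.range_eq_top.1 hrange (x.1 + x.2)
  have hy : y.1.1 + y.1.2 = x.1 + x.2 := hy
  have h1 := norm_le_of_mem_negGenerator_graph hT (sub_mem hx (hGle y.2))
  have h2 : (x - y.1).1 + (x - y.1).2 = 0 := by
    rw [Prod.fst_sub, Prod.snd_sub, sub_add_sub_comm, hy, sub_self]
  rw [h2, norm_zero, norm_le_zero_iff, Prod.fst_sub, sub_eq_zero] at h1
  have h3 : x = y.1 := Prod.ext h1 (by rw [h1] at hy; exact (add_left_cancel hy).symm)
  rw [h3]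
  exact y.2

theorem hasCore_of_eigenvectors [CompleteSpace E] (hT : ∀ t > 0, ∀ f, ‖T t f‖ ≤ ‖f‖)
    (he : ∀ i, ∀ t > 0, T t (e i) = Real.exp (-(l i * t)) • e i) (hl : ∀ i, 0 ≤ l i)
    (hdense : (Submodule.span ℝ (Set.range e)).topologicalClosure = ⊤) {D : Submodule ℝ E}
    (heD : ∀ i, e i ∈ D) (hD : D ≤ (negGenerator T).domain) : (negGenerator T).HasCore D := by
  refine ⟨hD, ?_⟩
  have hgraph := graph_eq_closure_eigenGraph hT he hl hdense
  have hle : (negGenerator T).domRestrict D ≤ negGenerator T := LinearPMap.domRestrict_le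
  have hclosed : (negGenerator T).IsClosed := by
    rw [LinearPMap.IsClosed, hgraph]
    exact Submodule.isClosed_topologicalClosure _
  have hclosable : ((negGenerator T).domRestrict D).IsClosable :=
    hclosed.isClosable.leIsClosable hle
  refine LinearPMap.eq_of_eq_graph ?_
  rw [← hclosable.graph_closure_eq_closure_graph]
  refine le_antisymm ?_ ?_
  · exact Submodule.topologicalClosure_minimal _ (LinearPMap.le_graph_of_le hle) hclosed
  · rw [hgraph]
    refine Submodule.topologicalClosure_mono (Submodule.span_le.2 ?_)
    rintro _ ⟨i, rfl⟩
    obtain ⟨y, hy, hy'⟩ := (LinearPMap.mem_graph_iff _).1 (eigenvector_mem_graph he i)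
    refine (LinearPMap.mem_graph_iff _).2 ⟨⟨y, ?_⟩, hy, hy'⟩
    exact ⟨by rw [hy]; exact heD i, y.2⟩

end Generator

end Multibranch

/-! ### Totality of the Haar functions, and ball indicators in the domain -/

namespace Multibranch

variable {B : FinSeq → ℕ} {q : ℝ} [hq : Fact (1 < q)]

namespace SB

/-- Induction over the π-system of balls. Intersecting with a fixed ball keeps `f` integrable, as
complements require. -/
theorem setIntegral_inter_ball_eq_zero (hB : ∀ s, 2 ≤ B s) {f : L2 B q}
    (hf : ∀ α N, ∫ x in ball α N, f x ∂(mu B q) = 0) (α : SB B q) (N : ℤ) {s : Set (SB B q)}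
    (hs : MeasurableSet s) : ∫ x in s ∩ ball α N, f x ∂(mu B q) = 0 := by
  have hK := measurableSet_ball α N
  have hint : IntegrableOn f (ball α N) (mu B q) :=
    integrableOn_Lp_of_measure_ne_top f one_le_two (mu_ball_ne_top hB α N)
  induction s, hs using MeasurableSpace.induction_on_inter (borel_eq_generateFrom_balls hB)
    isPiSystem_balls with
  | empty => simp
  | basic t ht =>
    rcases (t ∩ ball α N).eq_empty_or_nonempty with h | h
    · simp [h]
    · obtain ⟨β, M, h'⟩ := isPiSystem_balls t ht (ball α N) ⟨α, N, rfl⟩ h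
      rw [h']
      exact hf β M
  | compl t ht ih =>
    have h := integral_inter_add_sdiff ht hint
    rw [hf, Set.inter_comm, ih, zero_add] at h
    rwa [Set.inter_comm, ← Set.sdiff_eq]
  | iUnion g hd hg ih =>
    rw [Set.iUnion_inter, integral_iUnion (fun i => (hg i).inter hK)
      (fun i j hij => (hd hij).mono Set.inter_subset_left Set.inter_subset_left)
      (hint.mono_set (Set.iUnion_subset fun i => Set.inter_subset_right))]
    simp [ih]

theorem eq_zero_of_forall_setIntegral_ball (hB : ∀ s, 2 ≤ B s) {f : L2 B q}
    (hf : ∀ α N, ∫ x in ball α N, f x ∂(mu B q) = 0) : f = 0 := by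
  have hint : ∀ s, mu B q s < ⊤ → IntegrableOn f s (mu B q) := fun s hs =>
    integrableOn_Lp_of_measure_ne_top f one_le_two hs.ne
  rw [Lp.eq_zero_iff_ae_eq_zero]
  refine Lp.ae_eq_zero_of_forall_setIntegral_eq_zero f two_ne_zero ENNReal.ofNat_ne_top
    (fun s _ hs => hint s hs) fun s hs hs' => ?_
  have h := tendsto_setIntegral_of_monotone (μ := mu B q) (f := f)
    (s := fun L : ℕ => s ∩ ball (zero hB) L)
    (fun L => hs.inter (measurableSet_ball _ _))
    (fun _ _ h => Set.inter_subset_inter_right _ (monotone_ball (zero hB) h))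
    ((hint s hs').mono_set (Set.iUnion_subset fun _ => Set.inter_subset_left))
  rw [← Set.inter_iUnion, iUnion_ball, Set.inter_univ] at h
  simp only [setIntegral_inter_ball_eq_zero hB hf _ _ hs] at h
  exact tendsto_nhds_unique h tendsto_const_nhds

theorem topologicalClosure_span_ballLp (hB : ∀ s, 2 ≤ B s) :
    (Submodule.span ℝ (Set.range fun p : SB B q × ℤ => ballLp hB p.1 p.2)).topologicalClosure =
      ⊤ := by
  rw [Submodule.topologicalClosure_eq_top_iff, Submodule.eq_bot_iff]
  intro f hf
  refine eq_zero_of_forall_setIntegral_ball hB fun α N => ?_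
  rw [← L2.inner_indicatorConstLp_one (𝕜 := ℝ) (measurableSet_ball α N) (mu_ball_ne_top hB α N)]
  exact (Submodule.mem_orthogonal _ _).1 hf _ (Submodule.subset_span ⟨(α, N), rfl⟩)

omit hq in
theorem ballMass_add (hB : ∀ s, 2 ≤ B s) (β : SB B q) (M : ℤ) (n : ℕ) :
    massRatio β M n * ballMass β (M + n) = ballMass β M := by
  induction n with
  | zero => simp [massRatio]
  | succ n ih =>
    rw [← ih, massRatio_succ, Nat.cast_succ, ← add_assoc, ballMass_succ hB, mul_assoc,
      inv_mul_cancel_left₀ (br_pos hB _ _).ne']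

/-- The mass grows like the inverse of the ratio, so the squared norm is `massRatio β M n * ballMass
β M`, at most `2⁻ⁿ` times the mass. -/
theorem norm_massRatio_smul_ballLp (hB : ∀ s, 2 ≤ B s) (β : SB B q) (M : ℤ) (n : ℕ) :
    ‖massRatio β M n • ballLp hB β (M + n)‖ ≤ √(ballMass β M) * √(1 / 2) ^ n := by
  have h0 := (massRatio_pos hB β M n).le
  rw [norm_smul, Real.norm_of_nonneg h0, ballLp, norm_indicatorConstLp two_ne_zero
    ENNReal.ofNat_ne_top, norm_one, one_mul, mu_real_ball hB, ENNReal.toReal_ofNat,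
    ← Real.sqrt_eq_rpow, ← Real.sqrt_sq (pow_nonneg (Real.sqrt_nonneg _) n), ← pow_mul, mul_comm n,
    pow_mul, Real.sq_sqrt (by norm_num), ← Real.sqrt_mul (ballMass_pos hB β M).le]
  refine Real.le_sqrt_of_sq_le ?_
  rw [mul_pow, Real.sq_sqrt (ballMass_pos hB _ _).le, sq, mul_assoc, ballMass_add hB, mul_comm]
  exact mul_le_mul_of_nonneg_left (massRatio_le hB β M n) (ballMass_pos hB β M).le

theorem massRatio_smul_haarLp (hB : ∀ s, 2 ≤ B s) (β : SB B q) (M : ℤ) (n : ℕ) :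
    massRatio β M n • haarLp hB β (M + n) = massRatio β M n • ballLp hB β (M + n) -
      massRatio β M (n + 1) • ballLp hB β (M + (n + 1 : ℕ)) := by
  rw [haarLp, smul_sub, smul_smul, ← massRatio_succ, Nat.cast_succ, ← add_assoc]

theorem summable_sqrt_half_pow (C : ℝ) : Summable fun n : ℕ => C * √(1 / 2) ^ n := by
  refine (summable_geometric_of_lt_one (Real.sqrt_nonneg _) ?_).mul_left C
  rw [Real.sqrt_lt' one_pos]
  norm_num

theorem norm_massRatio_smul_haarLp (hB : ∀ s, 2 ≤ B s) (β : SB B q) (M : ℤ) (n : ℕ) :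
    ‖massRatio β M n • haarLp hB β (M + n)‖ ≤ 2 * √(ballMass β M) * √(1 / 2) ^ n := by
  rw [massRatio_smul_haarLp]
  refine (norm_sub_le _ _).trans ?_
  have h1 := norm_massRatio_smul_ballLp hB β M n
  have h2 := norm_massRatio_smul_ballLp hB β M (n + 1)
  have h3 : √(1 / 2) ^ (n + 1) ≤ √(1 / 2 : ℝ) ^ n := by
    refine pow_le_pow_of_le_one (Real.sqrt_nonneg _) ?_ (by omega)
    exact (Real.sqrt_le_sqrt (by norm_num)).trans_eq Real.sqrt_one
  have h4 := mul_le_mul_of_nonneg_left h3 (Real.sqrt_nonneg (ballMass β M))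
  linarith

/-- The partial sums telescope to the indicator minus its average over a large ball, and that
average tends to 0 in `L²`. -/
theorem hasSum_haarLp (hB : ∀ s, 2 ≤ B s) (β : SB B q) (M : ℤ) :
    HasSum (fun n : ℕ => massRatio β M n • haarLp hB β (M + n)) (ballLp hB β M) := by
  have hsum : Summable fun n : ℕ => massRatio β M n • haarLp hB β (M + n) :=
    Summable.of_norm_bounded (summable_sqrt_half_pow _) (norm_massRatio_smul_haarLp hB β M)
  have h0 : Tendsto (fun n : ℕ => massRatio β M n • ballLp hB β (M + n)) atTop (𝓝 0) :=
    squeeze_zero_norm (norm_massRatio_smul_ballLp hB β M)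
      (summable_sqrt_half_pow _).tendsto_atTop_zero
  have h1 := h0.const_sub (ballLp hB β M)
  rw [sub_zero] at h1
  refine (hsum.hasSum_iff_tendsto_nat).2 (h1.congr fun n => ?_)
  simp only [massRatio_smul_haarLp]
  rw [Finset.sum_range_sub' (fun n : ℕ => massRatio β M n • ballLp hB β (M + n)),
    massRatio_zero, one_smul, Nat.cast_zero, add_zero]

theorem topologicalClosure_span_haarLp (hB : ∀ s, 2 ≤ B s) :
    (Submodule.span ℝ (Set.range fun p : SB B q × ℤ => haarLp hB p.1 p.2)).topologicalClosure =
      ⊤ := by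
  rw [eq_top_iff, ← topologicalClosure_span_ballLp hB]
  refine Submodule.topologicalClosure_minimal _ (Submodule.span_le.2 ?_)
    (Submodule.isClosed_topologicalClosure _)
  rintro _ ⟨⟨β, M⟩, rfl⟩
  refine isClosed_closure.mem_of_tendsto (hasSum_haarLp hB β M) (Eventually.of_forall fun s => ?_)
  refine subset_closure (Submodule.sum_mem _ fun n _ => Submodule.smul_mem _ _ ?_)
  exact Submodule.subset_span ⟨(β, M + n), rfl⟩

theorem ballLp_mem_spanBalls (hB : ∀ s, 2 ≤ B s) (β : SB B q) (M : ℤ) :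
    ballLp hB β M ∈ spanBalls B q :=
  Submodule.subset_span ⟨β, M, ballLp_coeFn hB β M⟩

theorem haarLp_mem_spanBalls (hB : ∀ s, 2 ≤ B s) (β : SB B q) (M : ℤ) :
    haarLp hB β M ∈ spanBalls B q :=
  Submodule.sub_mem _ (ballLp_mem_spanBalls hB β M)
    (Submodule.smul_mem _ _ (ballLp_mem_spanBalls hB β (M + 1)))

/-- Rates from radius exponent `M` upward are at most `2 * a M`, so the Haar series still converges
when weighted by them. The pair of sums lies in the closure of the eigenvector graph, hence in the
graph of `H`. -/
theorem ballLp_mem_domain (hB : ∀ s, 2 ≤ B s) {a : ℤ → ℝ} (ha : ∀ N, a (N + 1) ≤ a N)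
    (ha_top : Tendsto a atTop (𝓝 0)) (β : SB B q) (M : ℤ) :
    ballLp hB β M ∈ (opH B q a).domain := by
  have hbound : ∀ n : ℕ,
      ‖massRatio β M n • rate a β (M + n) • haarLp hB β (M + n)‖ ≤
        2 * a M * (2 * √(ballMass β M)) * √(1 / 2) ^ n := fun n => by
    rw [smul_comm, norm_smul, Real.norm_of_nonneg (rate_nonneg hB ha ha_top β _), mul_assoc]
    refine mul_le_mul ?_ (norm_massRatio_smul_haarLp hB β M n) (norm_nonneg _) ?_
    · have := antitone_int_of_succ_le ha (show M ≤ M + n by omega)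
      linarith [rate_le hB ha ha_top β (M + n)]
    · linarith [nonneg_of_antitone_tendsto ha ha_top M]
  have hsum := (Summable.of_norm_bounded (summable_sqrt_half_pow _) hbound).hasSum
  have hgraph : ∀ n : ℕ, (massRatio β M n • haarLp hB β (M + n),
      massRatio β M n • rate a β (M + n) • haarLp hB β (M + n)) ∈
      eigenGraph (fun p : SB B q × ℤ => haarLp hB p.1 p.2) (fun p => rate a p.1 p.2) := fun n => by
    have h : (haarLp hB β (M + n), rate a β (M + n) • haarLp hB β (M + n)) ∈
        eigenGraph (fun p : SB B q × ℤ => haarLp hB p.1 p.2) (fun p => rate a p.1 p.2) :=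
      Submodule.subset_span ⟨(β, M + n), rfl⟩
    exact Submodule.smul_mem _ (massRatio β M n) h
  have hmem := closure_eigenGraph_le
    (fun t ht => (semigroupT_spec hB ha ha_top (le_of_lt ht)).2)
    (fun p t ht => semigroupT_haarLp hB ha ha_top (le_of_lt ht) p.1 p.2)
    (isClosed_closure.mem_of_tendsto ((hasSum_haarLp hB β M).prodMk hsum)
      (Eventually.of_forall fun s => subset_closure (Submodule.sum_mem _ fun n _ => hgraph n)))
  obtain ⟨y, hy, -⟩ := (LinearPMap.mem_graph_iff _).1 hmem
  rw [← show (y : L2 B q) = ballLp hB β M from hy]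
  exact y.2

end SB

theorem spanBalls_le_domain (hB : ∀ s, 2 ≤ B s) {a : ℤ → ℝ} (ha : ∀ N, a (N + 1) ≤ a N)
    (ha_top : Tendsto a atTop (𝓝 0)) : spanBalls B q ≤ (opH B q a).domain := by
  refine Submodule.span_le.2 ?_
  rintro f ⟨β, M, hf⟩
  have : f = SB.ballLp hB β M := Lp.ext (hf.trans (SB.ballLp_coeFn hB β M).symm)
  rw [this]
  exact SB.ballLp_mem_domain hB ha ha_top β M

end Multibranch

theorem corollary4p4 (B : Multibranch.FinSeq → ℕ) (hB : ∀ s, 2 ≤ B s)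
    (q : ℝ) [Fact (1 < q)]
    (a : ℤ → ℝ) (ha : ∀ N, a (N + 1) ≤ a N) (ha_top : Tendsto a atTop (𝓝 0))
    (ha_bot : (∃ W : ℝ, 0 < W ∧ Tendsto a atBot (𝓝 W)) ∨ Tendsto a atBot atTop) :
    Multibranch.spanBalls B q ≤ (Multibranch.opH B q a).domain ∧
      (Multibranch.opH B q a).HasCore (Multibranch.spanBalls B q) := by
  have hD := Multibranch.spanBalls_le_domain (q := q) hB ha ha_top
  exact ⟨hD, Multibranch.hasCore_of_eigenvectors
    (fun t ht => (Multibranch.SB.semigroupT_spec hB ha ha_top (le_of_lt ht)).2)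
    (fun p t ht => Multibranch.SB.semigroupT_haarLp hB ha ha_top (le_of_lt ht) p.1 p.2)
    (fun p => Multibranch.SB.rate_nonneg hB ha ha_top p.1 p.2)
    (Multibranch.SB.topologicalClosure_span_haarLp hB)
    (fun p => Multibranch.SB.haarLp_mem_spanBalls hB p.1 p.2) hD⟩
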